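/- Let $\mathcal H$ be a separable complex Hilbert space. For a bounded operator $T$ let $\sigma_{\rm ess}(T)$ be the set of $z\in\mathbb C$ such that $T-z$ is not Fredholm. Let $\widehat{\mathbb{SF}}_*(\mathcal H)$ be the set of self-adjoint Fredholm operators $F$ on $\mathcal H$ with $\|F\|=1$ and $\sigma_{\rm ess}(F)=\{-1,1\}$. For a norm continuous path $s\in[0,1]\mapsto F_s\in\widehat{\mathbb{SF}}_*(\mathcal H)$, a spectral partition consists of a partition $0=s_0<s_1<\dots<s_N=1$ and of numbers $-1<a_n<0<b_n<1$, $n=1,\dots,N$, such that $s\in[s_{n-1},s_n]\mapsto \chi_{(a_n,b_n]}(F_s)$ is norm continuous with constant finite rank for every $n$. The spectral flow of the path is $$\mathrm{SF}(s\in[0,1]\mapsto F_s)=\sum_{n=1}^N \mathrm{Tr}\big(\chi_{(a_n,0]}(F_{s_{n-1}})-\chi_{(a_n,0]}(F_{s_n})\big)\in\mathbb Z$$ for any spectral partition. Let $F\in\widehat{\mathbb{SF}}_*(\mathcal H)$ and let $U$ be a unitary operator on $\mathcal H$. Let $\Theta(F,U)$ be the set of norm continuous paths $s\in[0,1]\mapsto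 F_s\in\widehat{\mathbb{SF}}_*(\mathcal H)$ such that $F_0=F$, $F_s-F$ is compact for all $s\in[0,1]$, and $F_1=U^*FU$. Proposition. Every path in $\Theta(F,U)$ has a spectral partition, and its spectral flow is an integer that does not depend on the spectral partition. All paths in $\Theta(F,U)$ have the same spectral flow, which is denoted by $\mathrm{SF}(F,U)$. Moreover, $\Theta(F,U)$ is non-empty if and only if the commutator $[F,U]=FU-UF$ is compact, and in this case the path $s\in[0,1]\mapsto F+s\,U^*[F,U]$ belongs to $\Theta(F,U)$ and $$\mathrm{SF}(F,U)=\mathrm{SF}\big(s\in[0,1]\mapsto F+s\,U^*[F,U]\big).$$ -/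

import Mathlib

noncomputable section

namespace SpecFlow

variable {H : Type*} [NormedAddCommGroup H] [InnerProductSpace ℂ H] [CompleteSpace H]

/-- The essential spectrum: all `z` such that `T - z` is not a Fredholm operator. -/
def essSpectrum (T : H →L[ℂ] H) : Set ℂ :=
  {z | ¬ (T - z • (1 : H →L[ℂ] H)).IsFredholm}

variable (H) in
/-- Self-adjoint Fredholm operators with essential spectrum on both sides of `0`. -/
def SFStar : Set (H →L[ℂ] H) :=
  {F | IsSelfAdjoint F ∧ F.IsFredholm ∧
    (∃ x : ℝ, 0 < x ∧ (x : ℂ) ∈ essSpectrum F) ∧ (∃ x : ℝ, x < 0 ∧ (x : ℂ) ∈ essSpectrum F)}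

variable (H) in
/-- The elements of `SFStar H` with norm `1` and essential spectrum `{-1, 1}`. -/
def SFHat : Set (H →L[ℂ] H) :=
  {F | F ∈ SFStar H ∧ ‖F‖ = 1 ∧ essSpectrum F = {-1, 1}}

/-- If `F` is self-adjoint and `F - x` is Fredholm for a real `x`, then `F - y` is invertible for all
real `y ≠ x` close to `x`. -/
theorem isUnit_sub_of_isFredholm {F : H →L[ℂ] H} (hF : IsSelfAdjoint F) {x : ℝ}
    (hx : (F - (x : ℂ) • (1 : H →L[ℂ] H)).IsFredholm) :
    ∃ δ > 0, ∀ y : ℝ, y ≠ x → |y - x| < δ → IsUnit (F - (y : ℂ) • (1 : H →L[ℂ] H)) := by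
  have sa : ∀ y : ℝ, IsSelfAdjoint (F - (y : ℂ) • (1 : H →L[ℂ] H)) := fun y => by
    refine hF.sub ?_
    rw [IsSelfAdjoint, star_smul, star_one]
    simp
  set T := F - (x : ℂ) • (1 : H →L[ℂ] H) with hT
  have sT : ∀ u v : H, inner ℂ (T u) v = inner ℂ u (T v) := (sa x).isSymmetric
  have : FiniteDimensional ℂ T.ker := hx.finite_ker
  let R : T.kerᗮ →L[ℂ] H := T ∘L T.kerᗮ.subtypeL
  have hinj : Function.Injective R := by
    rw [injective_iff_map_eq_zero]
    intro w hw
    have h1 : (w : H) ∈ T.ker := hw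
    have h2 := w.2
    rw [Submodule.mem_orthogonal] at h2
    have := h2 _ h1
    exact Subtype.ext (inner_self_eq_zero.1 this)
  have hrange : Set.range R = (T.range : Set H) := by
    ext z
    constructor
    · rintro ⟨w, rfl⟩
      exact ⟨w, rfl⟩
    · rintro ⟨v, rfl⟩
      obtain ⟨k, hk, w, hw, rfl⟩ := T.ker.exists_add_mem_mem_orthogonal v
      refine ⟨⟨w, hw⟩, ?_⟩
      have : T k = 0 := hk
      simp [R, this]
  have hcl : IsClosed (Set.range R) := by
    rw [hrange]
    exact hx.isClosed_range
  obtain ⟨K, hK⟩ := R.antilipschitz_of_injective_of_isClosed_range hinj hcl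
  have hb : ∀ w ∈ T.kerᗮ, ‖w‖ ≤ K * ‖T w‖ := fun w hw => by
    simpa [R] using hK.le_mul_dist (⟨w, hw⟩ : T.kerᗮ) 0
  refine ⟨1 / (2 * (K + 1)), by positivity, fun y hy hyδ => ?_⟩
  set e : ℝ := y - x with he
  have he0 : e ≠ 0 := sub_ne_zero.2 hy
  have hS : F - (y : ℂ) • (1 : H →L[ℂ] H) = T - (e : ℂ) • (1 : H →L[ℂ] H) := by
    rw [hT, he, Complex.ofReal_sub, sub_smul]
    abel
  have hSa := sa y
  rw [hS] at hSa ⊢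
  set S := T - (e : ℂ) • (1 : H →L[ℂ] H) with hSdef
  have hSv : ∀ v, S v = T v - (e : ℂ) • v := fun v => by simp [hSdef]
  have bound : ∀ v, |e| * ‖v‖ ≤ ‖S v‖ := by
    intro v
    obtain ⟨k, hk, w, hw, rfl⟩ := T.ker.exists_add_mem_mem_orthogonal v
    have hTk : T k = 0 := hk
    have hwK := hb w hw
    have h1 : |e| * ‖w‖ ≤ ‖S w‖ := by
      have h2 : ‖T w‖ - |e| * ‖w‖ ≤ ‖S w‖ := by
        rw [hSv]
        refine le_trans (le_of_eq ?_) (norm_sub_norm_le _ _)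
        simp [norm_smul]
      have h3 : 2 * |e| * ‖w‖ ≤ ‖T w‖ := by
        have hK0 : (0 : ℝ) ≤ K := K.2
        rw [lt_div_iff₀ (by positivity)] at hyδ
        calc 2 * |e| * ‖w‖ ≤ 2 * |e| * (K * ‖T w‖) := by gcongr
          _ = (|e| * (2 * K)) * ‖T w‖ := by ring
          _ ≤ 1 * ‖T w‖ := by
            gcongr
            nlinarith [abs_nonneg e]
          _ = ‖T w‖ := one_mul _
      linarith
    have hkw : inner ℂ k w = 0 := (Submodule.mem_orthogonal _ _).1 hw k hk
    have hkS : inner ℂ ((-(e : ℂ)) • k) (S w) = 0 := by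
      rw [hSv, inner_sub_right, inner_smul_left, inner_smul_left, inner_smul_right, hkw, ← sT, hTk]
      simp
    have hsum : S (k + w) = (-(e : ℂ)) • k + S w := by
      rw [map_add, hSv k, hTk]
      simp
    have n1 := norm_add_sq_eq_norm_sq_add_norm_sq_of_inner_eq_zero k w hkw
    have n2 := norm_add_sq_eq_norm_sq_add_norm_sq_of_inner_eq_zero _ _ hkS
    rw [← hsum, norm_smul] at n2
    simp only [norm_neg, Complex.norm_real, Real.norm_eq_abs] at n2
    have h4 : (|e| * ‖w‖) * (|e| * ‖w‖) ≤ ‖S w‖ * ‖S w‖ :=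
      mul_self_le_mul_self (by positivity) h1
    refine abs_le_of_sq_le_sq' ?_ (norm_nonneg _) |>.2
    have h5 : (|e| * ‖k + w‖) ^ 2 = |e| ^ 2 * (‖k + w‖ * ‖k + w‖) := by ring
    rw [h5, n1, sq, sq, n2]
    linarith
  rw [ContinuousLinearMap.isUnit_iff_bijective,
    ContinuousLinearMap.bijective_iff_dense_range_and_antilipschitz]
  constructor
  · rw [Submodule.topologicalClosure_eq_top_iff, ContinuousLinearMap.orthogonal_range,
      ← ContinuousLinearMap.star_eq_adjoint, hSa.star_eq, Submodule.eq_bot_iff]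
    intro v hv
    have hv0 : S v = 0 := hv
    have := bound v
    rw [hv0, norm_zero] at this
    exact norm_le_zero_iff.1 (nonpos_of_mul_nonpos_right this (abs_pos.2 he0))
  · refine ⟨⟨|e|⁻¹, by positivity⟩, ContinuousLinearMap.antilipschitz_of_bound _ fun v => ?_⟩
    have := bound v
    change ‖v‖ ≤ |e|⁻¹ * ‖S v‖
    rwa [inv_mul_eq_div, le_div_iff₀ (abs_pos.2 he0), mul_comm]

/-- For `F ∈ SFHat H` and `-1 < a`, `b < 1`, the indicator function of `(a,b]` is continuous on the
spectrum of `F`. -/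
theorem continuousOn_indicator_spectrum {F : H →L[ℂ] H} (hF : F ∈ SFHat H) {a b : ℝ}
    (ha : -1 < a) (hb : b < 1) :
    ContinuousOn ((Set.Ioc a b).indicator (fun _ => (1 : ℝ))) (spectrum ℝ F) := by
  obtain ⟨⟨hsa, -, -, -⟩, -, hess⟩ := hF
  intro x _
  rcases le_or_gt x (-1) with h1 | h1
  · refine ContinuousAt.continuousWithinAt ?_
    refine (continuousAt_const (y := (0 : ℝ))).congr ?_
    filter_upwards [Iio_mem_nhds (lt_of_le_of_lt h1 ha)] with y hy
    exact (Set.indicator_of_notMem (fun h => absurd h.1 (not_lt.2 (le_of_lt hy))) _).symm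
  rcases le_or_gt 1 x with h2 | h2
  · refine ContinuousAt.continuousWithinAt ?_
    refine (continuousAt_const (y := (0 : ℝ))).congr ?_
    filter_upwards [Ioi_mem_nhds (lt_of_lt_of_le hb h2)] with y hy
    exact (Set.indicator_of_notMem (fun h => absurd h.2 (not_le.2 hy)) _).symm
  have hfr : (F - (x : ℂ) • (1 : H →L[ℂ] H)).IsFredholm := by
    by_contra h
    have hmem : (x : ℂ) ∈ essSpectrum F := h
    rw [hess] at hmem
    rcases hmem with h | h
    · have : x = -1 := by exact_mod_cast h
      linarith
    · have : x = 1 := by exact_mod_cast Set.mem_singleton_iff.1 h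
      linarith
  obtain ⟨δ, hδ, hun⟩ := isUnit_sub_of_isFredholm hsa hfr
  refine ContinuousWithinAt.congr_of_eventuallyEq
    (continuousWithinAt_const (b := (Set.Ioc a b).indicator (fun _ => (1 : ℝ)) x)) ?_ rfl
  filter_upwards [self_mem_nhdsWithin, mem_nhdsWithin_of_mem_nhds (Metric.ball_mem_nhds x hδ)]
    with y hy hyb
  by_cases hyx : y = x
  · rw [hyx]
  · exfalso
    have := hun y hyx (by simpa [Real.dist_eq] using hyb)
    rw [spectrum.mem_iff, IsUnit.sub_iff] at hy
    apply hy
    convert this using 2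
    ext v
    simp [Algebra.algebraMap_eq_smul_one]

/-- The spectral projection `χ_(a,b](F)` of a self-adjoint operator `F`, through the continuous
functional calculus. It is used for `F ∈ SFHat H` and `-1 < a`, `b < 1`: then the indicator function
of `(a,b]` is continuous on the spectrum of `F`, see `continuousOn_indicator_spectrum`. -/
def specProj (F : H →L[ℂ] H) (a b : ℝ) : H →L[ℂ] H :=
  cfc ((Set.Ioc a b).indicator (fun _ => (1 : ℝ))) F

/-- The trace of a finite rank operator, computed on its (invariant) range. -/
def finRankTrace (T : H →L[ℂ] H) : ℂ :=
  LinearMap.trace ℂ T.range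
    ((T : H →ₗ[ℂ] H).restrict (p := T.range) (q := T.range) (fun x _ => ⟨x, rfl⟩))

/-- A partition `0 = s₀ < s₁ < ⋯ < s_N = 1` with numbers `-1 < aₙ < 0 < bₙ < 1`, such that
`s ↦ χ_(aₙ,bₙ](γ s)` is norm continuous with constant finite rank on the `n`-th interval. -/
structure SpectralPartition (γ : C(unitInterval, H →L[ℂ] H)) where
  N : ℕ
  s : Fin (N + 1) → unitInterval
  a : Fin N → ℝ
  b : Fin N → ℝ
  strictMono_s : StrictMono s
  s_zero : s 0 = 0
  s_last : s (Fin.last N) = 1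
  a_mem : ∀ n, a n ∈ Set.Ioo (-1 : ℝ) 0
  b_mem : ∀ n, b n ∈ Set.Ioo (0 : ℝ) 1
  continuousOn_proj : ∀ n,
    ContinuousOn (fun t => specProj (γ t) (a n) (b n)) (Set.Icc (s n.castSucc) (s n.succ))
  finite_rank : ∀ n, ∀ t ∈ Set.Icc (s n.castSucc) (s n.succ),
    FiniteDimensional ℂ (specProj (γ t) (a n) (b n)).range
  constant_rank : ∀ n, ∃ k : ℕ, ∀ t ∈ Set.Icc (s n.castSucc) (s n.succ),
    Module.finrank ℂ (specProj (γ t) (a n) (b n)).range = k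

/-- `∑ₙ Tr (χ_(aₙ,0](γ sₙ₋₁) - χ_(aₙ,0](γ sₙ))`. -/
def SpectralPartition.flow {γ : C(unitInterval, H →L[ℂ] H)} (D : SpectralPartition γ) : ℂ :=
  ∑ n : Fin D.N, finRankTrace
    (specProj (γ (D.s n.castSucc)) (D.a n) 0 - specProj (γ (D.s n.succ)) (D.a n) 0)

/-- The spectral flow of a path in `SFHat H`: the integer given by a spectral partition of it. -/
def spectralFlow (γ : C(unitInterval, H →L[ℂ] H)) : ℤ :=
  Classical.epsilon fun n : ℤ => ∃ D : SpectralPartition γ, D.flow = (n : ℂ)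

/-- `Θ(F,U)`: norm continuous paths in `SFHat H` from `F` to `U* F U` through compact perturbations
of `F`. -/
def Theta (F : H →L[ℂ] H) (U : unitary (H →L[ℂ] H)) : Set C(unitInterval, H →L[ℂ] H) :=
  {γ | (∀ t, γ t ∈ SFHat H) ∧ γ 0 = F ∧ (∀ t, IsCompactOperator (γ t - F)) ∧
    γ 1 = star (U : H →L[ℂ] H) * F * (U : H →L[ℂ] H)}

open Classical in
/-- `SF(F,U)`: the spectral flow of some path in `Θ(F,U)` (and `0` if there is no such path). -/
def spectralFlowPair (F : H →L[ℂ] H) (U : unitary (H →L[ℂ] H)) : ℤ :=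
  if h : (Theta F U).Nonempty then spectralFlow h.some else 0

/-- The commutator `[F,U] = FU - UF`. -/
def comm (F : H →L[ℂ] H) (U : unitary (H →L[ℂ] H)) : H →L[ℂ] H :=
  F * (U : H →L[ℂ] H) - (U : H →L[ℂ] H) * F

/-- The path `s ↦ F + s U* [F,U]`. -/
def linePath (F : H →L[ℂ] H) (U : unitary (H →L[ℂ] H)) : C(unitInterval, H →L[ℂ] H) where
  toFun s := F + (s : ℝ) • (star (U : H →L[ℂ] H) * comm F U)
  continuous_toFun := by fun_prop

end SpecFlow

end

/-! Let P_s be the spectral projection of F_s for (-∞,0]. Along a path in Θ(F,U) the P_s differ from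
one another by compact operators, so any two of them have a relative index: the index of Q regarded
as a map from ran P to ran Q. The heart of the proof is that the flow of every spectral partition
equals the relative index of P_0 and P_1 (`flow_eq_relIndex`). This number sees only the end points
F and U*FU, which gives integrality and independence of both partition and path.

The relative index is additive (`relIndex_trans`), and it vanishes along norm continuous families of
projections with compact differences, because projections at distance less than 1 compress
injectively onto each other in both directions. On one interval of a partition the projections for
(-∞,a_n] form such a family (`continuousOn_lowerProj`), and raising the level from a_n to 0 adds the
finite rank of χ_(a_n,0]. Hence each trace is the relative index of the projections P_s at the two
ends of the interval, and the sum telescopes.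

Partitions exist because 0 is at most an isolated point of each spectrum and [0,1] is compact.
Finally U*FU - F = U*[F,U], so compactness of the commutator is necessary; when it holds, the
straight path consists of convex combinations of F and U*FU, and its unchanged essential spectrum
forces the norm to stay equal to 1. -/

noncomputable section

namespace SpecFlow

open Module

/-! ### Algebraic index of linear maps -/

section Index

variable {K V W X : Type*} [Field K] [AddCommGroup V] [Module K V] [AddCommGroup W] [Module K W]
  [AddCommGroup X] [Module K X]

/-- A linear map has finite index if its kernel and its cokernel are finite-dimensional. -/
structure HasFiniteIndex (f : V →ₗ[K] W) : Prop where
  ker : FiniteDimensional K (LinearMap.ker f)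
  coker : FiniteDimensional K (W ⧸ LinearMap.range f)

/-- The index of a linear map: the dimension of its kernel minus that of its cokernel. -/
def linIndex (f : V →ₗ[K] W) : ℤ :=
  finrank K (LinearMap.ker f) - finrank K (W ⧸ LinearMap.range f)

theorem HasFiniteIndex.of_comp {f : V →ₗ[K] W} {g : W →ₗ[K] V} (h₁ : HasFiniteIndex (g ∘ₗ f))
    (h₂ : HasFiniteIndex (f ∘ₗ g)) : HasFiniteIndex f := by
  have := h₁.ker
  have := h₂.coker
  exact ⟨Submodule.finiteDimensional_of_le (LinearMap.ker_le_ker_comp f g),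
    Submodule.CoFG.of_le (LinearMap.range_comp_le_range g f) h₂.coker⟩

/-- `f` maps ker (g f) onto ran f ∩ ker g with kernel ker f; rank-nullity does the rest. -/
theorem finrank_ker_comp {f : V →ₗ[K] W} {g : W →ₗ[K] X} (hf : HasFiniteIndex f)
    (hg : HasFiniteIndex g) :
    FiniteDimensional K (LinearMap.ker (g ∘ₗ f)) ∧
    finrank K (LinearMap.ker (g ∘ₗ f)) = finrank K (LinearMap.ker f) +
      finrank K (LinearMap.range f ⊓ LinearMap.ker g : Submodule K W) := by
  have := hf.ker
  have := hg.ker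
  set N := LinearMap.ker (g ∘ₗ f) with hN
  have hmap : N.map f = LinearMap.range f ⊓ LinearMap.ker g := by
    rw [hN, LinearMap.ker_comp, Submodule.map_comap_eq]
  have hle : LinearMap.ker f ≤ N := LinearMap.ker_le_ker_comp f g
  have hfd : FiniteDimensional K N := by
    rw [← Submodule.fg_iff_finiteDimensional]
    refine Submodule.fg_of_fg_map_of_fg_inf_ker f ?_ ?_
    · rw [hmap, Submodule.fg_iff_finiteDimensional]
      exact Submodule.finiteDimensional_of_le inf_le_right
    · rw [inf_eq_right.2 hle, Submodule.fg_iff_finiteDimensional]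
      infer_instance
  refine ⟨hfd, ?_⟩
  have h := LinearMap.finrank_range_add_finrank_ker (f.domRestrict N)
  rw [← h, LinearMap.range_domRestrict, hmap, LinearMap.ker_domRestrict,
    (Submodule.comapSubtypeEquivOfLe hle).finrank_eq, add_comm]

theorem ker_factor_eq_map_mkQ {R S : Submodule K W} (h : R ≤ S) :
    LinearMap.ker (Submodule.factor h) = S.map R.mkQ := by
  ext x
  obtain ⟨w, rfl⟩ := R.mkQ_surjective x
  rw [← Submodule.mem_comap (f := R.mkQ) (p := S.map R.mkQ), Submodule.comap_map_mkQ,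
    sup_eq_right.2 h]
  simp

/-- The kernel of W/R → W/(R+S) is the image of S in W/R, that is S/(R ∩ S). This cancels the
correction terms of kernel and cokernel in `linIndex_comp`. -/
theorem finrank_quotient_eq_add_of_sup (R S : Submodule K W) [FiniteDimensional K (W ⧸ R)]
    [FiniteDimensional K S] :
    finrank K (W ⧸ R) + finrank K (R ⊓ S : Submodule K W) =
      finrank K (W ⧸ (R ⊔ S)) + finrank K S := by
  have h₁ := LinearMap.finrank_range_add_finrank_ker (Submodule.factor (le_sup_left : R ≤ R ⊔ S))
  have h₂ := LinearMap.finrank_range_add_finrank_ker (R.mkQ.domRestrict S)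
  rw [LinearMap.range_eq_top.2 (Submodule.factor_surjective _), finrank_top] at h₁
  have h₃ : LinearMap.ker (Submodule.factor (le_sup_left : R ≤ R ⊔ S)) =
      LinearMap.range (R.mkQ.domRestrict S) := by
    rw [LinearMap.range_domRestrict, ker_factor_eq_map_mkQ, Submodule.map_sup]
    simp
  have h₄ : finrank K (LinearMap.ker (R.mkQ.domRestrict S)) = finrank K (R ⊓ S : Submodule K W) := by
    rw [← (Submodule.comapSubtypeEquivOfLe (inf_le_right : R ⊓ S ≤ S)).finrank_eq,
      LinearMap.ker_domRestrict, Submodule.ker_mkQ]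
    rw [Submodule.comap_inf, (Submodule.comap_subtype_eq_top (p := S)).2 le_rfl, inf_top_eq]
  rw [h₃] at h₁
  omega

theorem finrank_coker_comp {f : V →ₗ[K] W} {g : W →ₗ[K] X} (hf : HasFiniteIndex f)
    (hg : HasFiniteIndex g) :
    FiniteDimensional K (X ⧸ LinearMap.range (g ∘ₗ f)) ∧
    finrank K (X ⧸ LinearMap.range (g ∘ₗ f)) = finrank K (X ⧸ LinearMap.range g) +
      finrank K (W ⧸ (LinearMap.range f ⊔ LinearMap.ker g)) := by
  have := hf.coker
  have := hg.coker
  have hle := LinearMap.range_comp_le_range f g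
  set a : W →ₗ[K] X ⧸ LinearMap.range (g ∘ₗ f) := (LinearMap.range (g ∘ₗ f)).mkQ ∘ₗ g
  set b := Submodule.factor hle with hb
  have hker : LinearMap.ker a = LinearMap.range f ⊔ LinearMap.ker g := by
    rw [LinearMap.ker_comp, Submodule.ker_mkQ, LinearMap.range_comp, Submodule.comap_map_eq]
  have hrange : LinearMap.ker b = LinearMap.range a := by
    rw [hb, ker_factor_eq_map_mkQ, ← LinearMap.range_comp]
  have e := a.quotKerEquivRange
  rw [hker, ← hrange] at e
  have hfin : FiniteDimensional K (W ⧸ (LinearMap.range f ⊔ LinearMap.ker g)) :=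
    Submodule.CoFG.of_le le_sup_left hf.coker
  have hkb : FiniteDimensional K (LinearMap.ker b) := Module.Finite.equiv e
  have hfd : FiniteDimensional K (X ⧸ LinearMap.range (g ∘ₗ f)) := by
    refine Module.finite_def.2 (Submodule.fg_of_fg_map_of_fg_inf_ker b ?_ ?_)
    · exact IsNoetherian.noetherian _
    · rw [top_inf_eq, Submodule.fg_iff_finiteDimensional]
      exact hkb
  refine ⟨hfd, ?_⟩
  rw [e.finrank_eq, ← LinearMap.finrank_range_add_finrank_ker b,
    LinearMap.range_eq_top.2 (Submodule.factor_surjective _), finrank_top]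

theorem HasFiniteIndex.comp {f : V →ₗ[K] W} {g : W →ₗ[K] X} (hg : HasFiniteIndex g)
    (hf : HasFiniteIndex f) : HasFiniteIndex (g ∘ₗ f) :=
  ⟨(finrank_ker_comp hf hg).1, (finrank_coker_comp hf hg).1⟩

theorem linIndex_comp {f : V →ₗ[K] W} {g : W →ₗ[K] X} (hg : HasFiniteIndex g)
    (hf : HasFiniteIndex f) : linIndex (g ∘ₗ f) = linIndex g + linIndex f := by
  have := hf.coker
  have := hg.ker
  have h₁ := (finrank_ker_comp hf hg).2
  have h₂ := (finrank_coker_comp hf hg).2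
  have h₃ := finrank_quotient_eq_add_of_sup (LinearMap.range f) (LinearMap.ker g)
  unfold linIndex
  omega

theorem HasFiniteIndex.of_bijective {f : V →ₗ[K] W} (hf : Function.Bijective f) :
    HasFiniteIndex f := by
  constructor
  · rw [LinearMap.ker_eq_bot.2 hf.1]
    infer_instance
  · rw [LinearMap.range_eq_top.2 hf.2]
    infer_instance

theorem linIndex_of_injective {f : V →ₗ[K] W} (hf : Function.Injective f) :
    linIndex f = -finrank K (W ⧸ LinearMap.range f) := by
  rw [linIndex, LinearMap.ker_eq_bot.2 hf]
  simp

theorem linIndex_of_surjective {f : V →ₗ[K] W} (hf : Function.Surjective f) :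
    linIndex f = finrank K (LinearMap.ker f) := by
  rw [linIndex, LinearMap.range_eq_top.2 hf,
    Module.finrank_zero_of_subsingleton (M := W ⧸ (⊤ : Submodule K W))]
  simp

theorem linIndex_of_bijective {f : V →ₗ[K] W} (hf : Function.Bijective f) : linIndex f = 0 := by
  rw [linIndex_of_surjective hf.2, LinearMap.ker_eq_bot.2 hf.1]
  simp

/-- The kernels of `1 + A B` and `1 + B A` are isomorphic. -/
def kerOneAddEquiv (A : W →ₗ[K] V) (B : V →ₗ[K] W) :
    LinearMap.ker (LinearMap.id + A ∘ₗ B) ≃ₗ[K] LinearMap.ker (LinearMap.id + B ∘ₗ A) :=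
  have hl : ∀ x ∈ LinearMap.ker (LinearMap.id + A ∘ₗ B),
      B x ∈ LinearMap.ker (LinearMap.id + B ∘ₗ A) := fun x hx => by
    have := congrArg B (LinearMap.mem_ker.1 hx)
    simpa using this
  have hr : ∀ y ∈ LinearMap.ker (LinearMap.id + B ∘ₗ A),
      (-A) y ∈ LinearMap.ker (LinearMap.id + A ∘ₗ B) := fun y hy => by
    have := congrArg A (LinearMap.mem_ker.1 hy)
    rw [LinearMap.mem_ker, ← neg_eq_zero]
    simpa [add_comm] using this
  -- On the kernel x = -A B x, so -A inverts B.
  LinearEquiv.ofLinearMap (B.restrict hl) ((-A).restrict hr)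
    (by
      ext ⟨y, hy⟩
      have := LinearMap.mem_ker.1 hy
      simpa [neg_eq_iff_add_eq_zero, add_comm] using this)
    (by
      ext ⟨x, hx⟩
      have := LinearMap.mem_ker.1 hx
      simpa [neg_eq_iff_add_eq_zero, add_comm] using this)

/-- The cokernels of `1 + A B` and `1 + B A` are isomorphic. -/
def cokerOneAddEquiv (A : W →ₗ[K] V) (B : V →ₗ[K] W) :
    (V ⧸ LinearMap.range (LinearMap.id + A ∘ₗ B)) ≃ₗ[K]
      (W ⧸ LinearMap.range (LinearMap.id + B ∘ₗ A)) :=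
  LinearEquiv.ofLinearMap
    (Submodule.mapQ _ _ B (by
      rintro _ ⟨x, rfl⟩
      exact ⟨B x, by simp⟩))
    (Submodule.mapQ _ _ (-A) (by
      rintro _ ⟨x, rfl⟩
      exact ⟨-A x, by simp [add_comm]⟩))
    (by
      refine Submodule.linearMap_qext _ (LinearMap.ext fun y => ?_)
      refine (Submodule.Quotient.eq _).2 ⟨-y, ?_⟩
      simp [sub_eq_add_neg, add_comm])
    (by
      refine Submodule.linearMap_qext _ (LinearMap.ext fun y => ?_)
      refine (Submodule.Quotient.eq _).2 ⟨-y, ?_⟩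
      simp [sub_eq_add_neg, add_comm])

/-- Factoring S through its range and exchanging the two factors replaces 1 + S by an endomorphism
of a finite-dimensional space, whose index is zero. -/
theorem hasFiniteIndex_id_add {S : V →ₗ[K] V} (hS : FiniteDimensional K (LinearMap.range S)) :
    HasFiniteIndex (LinearMap.id + S) ∧ linIndex (LinearMap.id + S) = 0 := by
  have hfac : S = (LinearMap.range S).subtype ∘ₗ S.rangeRestrict := by ext; rfl
  have e₁ := kerOneAddEquiv (LinearMap.range S).subtype S.rangeRestrict
  have e₂ := cokerOneAddEquiv (LinearMap.range S).subtype S.rangeRestrict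
  rw [← hfac] at e₁ e₂
  refine ⟨⟨Module.Finite.equiv e₁.symm, Module.Finite.equiv e₂.symm⟩, ?_⟩
  rw [linIndex, e₁.finrank_eq, e₂.finrank_eq]
  set T := LinearMap.id + S.rangeRestrict ∘ₗ (LinearMap.range S).subtype
  have h₁ := LinearMap.finrank_range_add_finrank_ker T
  have h₂ := Submodule.finrank_quotient_add_finrank (LinearMap.range T)
  omega

end Index

/-! ### Compact perturbations and Fredholm operators -/

section Compact

variable {E : Type*} [NormedAddCommGroup E] [InnerProductSpace ℂ E]

/-- A compact operator on a Hilbert space is the sum of an operator of small norm and of a finite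
rank operator. -/
theorem exists_finiteRank_approx {T : E →L[ℂ] E} (hT : IsCompactOperator T) {ε : ℝ} (hε : 0 < ε) :
    ∃ S : E →L[ℂ] E, FiniteDimensional ℂ S.range ∧ ‖T - S‖ ≤ ε := by
  have hc : IsCompact (closure (T '' Metric.closedBall 0 1)) :=
    hT.isCompact_closure_image_closedBall 1
  obtain ⟨t, -, htf, ht⟩ := hc.finite_cover_balls hε
  have : FiniteDimensional ℂ (Submodule.span ℂ t) := FiniteDimensional.span_of_finite ℂ htf
  -- The orthogonal projection onto the span of a finite ε-net of the image of the unit ball moves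
  -- no point of that image by more than ε.
  set p := (Submodule.span ℂ t).starProjection
  refine ⟨p ∘L T, ?_, ?_⟩
  · refine Submodule.finiteDimensional_of_le (S₂ := Submodule.span ℂ t) ?_
    rintro _ ⟨x, rfl⟩
    exact Submodule.starProjection_apply_mem _ _
  · refine ContinuousLinearMap.opNorm_le_of_unit_norm hε.le fun x hx => ?_
    have hx' : T x ∈ closure (T '' Metric.closedBall 0 1) :=
      subset_closure ⟨x, by simp [hx], rfl⟩
    obtain ⟨y, hy, hxy⟩ := Set.mem_iUnion₂.1 (ht hx')
    have h₁ : ‖T x - p (T x)‖ ≤ ‖T x - y‖ := by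
      rw [Submodule.starProjection_minimal]
      exact ciInf_le ⟨0, by rintro _ ⟨z, rfl⟩; positivity⟩
        (⟨y, Submodule.subset_span hy⟩ : Submodule.span ℂ t)
    rw [Metric.mem_ball, dist_eq_norm] at hxy
    exact h₁.trans hxy.le

theorem isCompactOperator_mul_left {T : E →L[ℂ] E} (hT : IsCompactOperator T) (A : E →L[ℂ] E) :
    IsCompactOperator (A * T : E →L[ℂ] E) := hT.clm_comp A

theorem isCompactOperator_mul_right {T : E →L[ℂ] E} (hT : IsCompactOperator T) (A : E →L[ℂ] E) :
    IsCompactOperator (T * A : E →L[ℂ] E) := hT.comp_clm A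

theorem isCompactOperator_of_finiteDimensional_range {S : E →L[ℂ] E}
    (hS : FiniteDimensional ℂ S.range) : IsCompactOperator S := by
  have : ProperSpace S.range := FiniteDimensional.proper ℂ S.range
  have h := isCompactOperator_of_locallyCompactSpace_dom (S.codRestrict S.range fun x => ⟨x, rfl⟩)
  exact h.clm_comp S.range.subtypeL

theorem isCompactOperator_sub_symm {S T : E →L[ℂ] E} (h : IsCompactOperator (S - T)) :
    IsCompactOperator (T - S) := by
  have := h.neg
  rwa [← FunLike.coe_neg, neg_sub] at this

variable [CompleteSpace E]

/-- A compact perturbation of the identity is, on either side, a product of an invertible operator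
and of a finite rank perturbation of the identity. -/
theorem exists_isUnit_finiteRank {T : E →L[ℂ] E} (hT : IsCompactOperator T) :
    ∃ w S : E →L[ℂ] E, IsUnit w ∧ FiniteDimensional ℂ S.range ∧ 1 + T = w * (1 + S) ∧
      ∃ S' : E →L[ℂ] E, FiniteDimensional ℂ S'.range ∧ 1 + T = (1 + S') * w := by
  obtain ⟨S, hS, hTS⟩ := exists_finiteRank_approx hT (ε := 1 / 2) (by norm_num)
  -- Neumann series; this unit w satisfies 1 + T = w + S, from which S can be factored out on either
  -- side.
  have hw : IsUnit (1 + (T - S)) := by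
    have := (Units.oneSub (-(T - S)) (by rw [norm_neg]; linarith)).isUnit
    rwa [Units.val_oneSub, sub_neg_eq_add] at this
  obtain ⟨w, hw⟩ := hw
  refine ⟨w, ↑w⁻¹ * S, w.isUnit, ?_, ?_, S * ↑w⁻¹, ?_, ?_⟩
  · exact Submodule.finiteDimensional_of_le (S₂ := S.range.map (↑w⁻¹ : E →L[ℂ] E).toLinearMap)
      (by rintro _ ⟨x, rfl⟩; exact ⟨S x, ⟨x, rfl⟩, rfl⟩)
  · rw [mul_add, mul_one, ← mul_assoc, Units.mul_inv, one_mul, hw]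
    abel
  · exact Submodule.finiteDimensional_of_le (S₂ := S.range)
      (by rintro _ ⟨x, rfl⟩; exact ⟨_, rfl⟩)
  · rw [add_mul, one_mul, mul_assoc, Units.inv_mul, mul_one, hw]
    abel

/-- A compact perturbation of the identity of a Hilbert space has index zero. -/
theorem hasFiniteIndex_one_add_of_isCompactOperator {T : E →L[ℂ] E} (hT : IsCompactOperator T) :
    HasFiniteIndex (1 + T : E →L[ℂ] E).toLinearMap ∧
      linIndex (1 + T : E →L[ℂ] E).toLinearMap = 0 := by
  obtain ⟨w, S, hw, hS, h, -⟩ := exists_isUnit_finiteRank hT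
  have hb := ContinuousLinearMap.isUnit_iff_bijective.1 hw
  have hw' : HasFiniteIndex w.toLinearMap := .of_bijective hb
  obtain ⟨h₁, h₂⟩ := hasFiniteIndex_id_add (S := S.toLinearMap) hS
  have heq : (1 + T : E →L[ℂ] E).toLinearMap = w.toLinearMap ∘ₗ (LinearMap.id + S.toLinearMap) := by
    rw [h]
    rfl
  rw [heq]
  refine ⟨hw'.comp h₁, ?_⟩
  rw [linIndex_comp hw' h₁, h₂, linIndex_of_bijective hb, add_zero]

open scoped LinearMap.FiniteRangeSetoid

/-- An operator which is invertible from both sides up to compact operators is Fredholm. -/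
theorem isFredholm_of_isCompactOperator {u v : E →L[ℂ] E} (hl : IsCompactOperator (v * u - 1 : E →L[ℂ] E))
    (hr : IsCompactOperator (u * v - 1 : E →L[ℂ] E)) : u.IsFredholm := by
  obtain ⟨w₁, S₁, ⟨w₁, rfl⟩, hS₁, h₁, -⟩ := exists_isUnit_finiteRank (T := v * u - 1) hl
  obtain ⟨w₂, -, ⟨w₂, rfl⟩, -, -, S₂, hS₂, h₂⟩ := exists_isUnit_finiteRank (T := u * v - 1) hr
  rw [add_sub_cancel] at h₁ h₂
  set a : E →L[ℂ] E := ↑w₁⁻¹ * v with ha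
  set b : E →L[ℂ] E := v * ↑w₂⁻¹ with hb
  have hau : a * u = 1 + S₁ := by
    rw [ha, mul_assoc, h₁, ← mul_assoc, Units.inv_mul, one_mul]
  have hub : u * b = 1 + S₂ := by
    rw [hb, ← mul_assoc, h₂, mul_assoc, Units.mul_inv, mul_one]
  have e₁ : a.toLinearMap ∘ₗ u.toLinearMap ≈ LinearMap.id := by
    rw [LinearMap.FiniteRangeSetoid.equiv_iff_hasFiniteRange]
    have : a.toLinearMap ∘ₗ u.toLinearMap - LinearMap.id = S₁.toLinearMap := by
      rw [sub_eq_iff_eq_add']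
      exact congrArg ContinuousLinearMap.toLinearMap hau
    rw [this]
    exact Submodule.fg_iff_finiteDimensional _ |>.2 hS₁
  have e₂ : u.toLinearMap ∘ₗ b.toLinearMap ≈ LinearMap.id := by
    rw [LinearMap.FiniteRangeSetoid.equiv_iff_hasFiniteRange]
    have : u.toLinearMap ∘ₗ b.toLinearMap - LinearMap.id = S₂.toLinearMap := by
      rw [sub_eq_iff_eq_add']
      exact congrArg ContinuousLinearMap.toLinearMap hub
    rw [this]
    exact Submodule.fg_iff_finiteDimensional _ |>.2 hS₂
  refine ContinuousLinearMap.IsFredholm.of_isQuasiInverse (v := a) ⟨e₁, ?_⟩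
  -- A left and a right inverse modulo finite rank agree modulo finite rank.
  have e₃ : a.toLinearMap ≈ b.toLinearMap := by
    calc a.toLinearMap = a.toLinearMap ∘ₗ LinearMap.id := by simp
      _ ≈ a.toLinearMap ∘ₗ (u.toLinearMap ∘ₗ b.toLinearMap) := by grw [e₂]
      _ = (a.toLinearMap ∘ₗ u.toLinearMap) ∘ₗ b.toLinearMap := by rw [LinearMap.comp_assoc]
      _ ≈ LinearMap.id ∘ₗ b.toLinearMap := by grw [e₁]
      _ = b.toLinearMap := by simp
  change u.toLinearMap ∘ₗ a.toLinearMap ≈ LinearMap.id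
  grw [e₃, e₂]

/-- A compact perturbation of a Fredholm operator is Fredholm. -/
theorem isFredholm_of_isCompactOperator_sub {u u' : E →L[ℂ] E} (hu : u.IsFredholm)
    (h : IsCompactOperator (u' - u)) : u'.IsFredholm := by
  obtain ⟨v, h₁, h₂⟩ := hu.exists_isQuasiInverse
  have k₁ : IsCompactOperator (v * u - 1 : E →L[ℂ] E) :=
    isCompactOperator_of_finiteDimensional_range ((Submodule.fg_iff_finiteDimensional _).1
      (LinearMap.FiniteRangeSetoid.equiv_iff_hasFiniteRange.1 h₁.equiv))
  have k₂ : IsCompactOperator (u * v - 1 : E →L[ℂ] E) :=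
    isCompactOperator_of_finiteDimensional_range ((Submodule.fg_iff_finiteDimensional _).1
      (LinearMap.FiniteRangeSetoid.equiv_iff_hasFiniteRange.1 h₂.equiv))
  refine isFredholm_of_isCompactOperator (v := v) ?_ ?_
  · have : v * u' - 1 = v * (u' - u) + (v * u - 1) := by noncomm_ring
    rw [this]
    exact (isCompactOperator_mul_left h v).add k₁
  · have : u' * v - 1 = (u' - u) * v + (u * v - 1) := by noncomm_ring
    rw [this]
    exact (isCompactOperator_mul_right h v).add k₂

theorem essSpectrum_eq_of_isCompactOperator_sub {F G : E →L[ℂ] E}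
    (h : IsCompactOperator (G - F)) : essSpectrum G = essSpectrum F := by
  have h' := isCompactOperator_sub_symm h
  ext z
  refine not_congr ⟨fun hG => ?_, fun hF => ?_⟩
  · refine isFredholm_of_isCompactOperator_sub hG ?_
    rwa [sub_sub_sub_cancel_right]
  · refine isFredholm_of_isCompactOperator_sub hF ?_
    rwa [sub_sub_sub_cancel_right]

end Compact

/-! ### Relative index of projections, and traces -/

section Projections

variable {E : Type*} [NormedAddCommGroup E] [InnerProductSpace ℂ E]

/-- The operator `Q`, as a map from the range of `P` to the range of `Q`. -/
def compress (P Q : E →L[ℂ] E) : P.range →ₗ[ℂ] Q.range :=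
  Q.toLinearMap.rangeRestrict ∘ₗ P.range.subtype

/-- The relative index of two projections `P` and `Q`. -/
def relIndex (P Q : E →L[ℂ] E) : ℤ := linIndex (compress P Q)

@[simp]
theorem coe_compress (P Q : E →L[ℂ] E) (x : P.range) : (compress P Q x : E) = Q x := rfl

theorem apply_of_mem_range {P : E →L[ℂ] E} (hP : IsIdempotentElem P) {x : E} (hx : x ∈ P.range) :
    P x = x := by
  obtain ⟨y, rfl⟩ := hx
  exact congrArg (fun T : E →L[ℂ] E => T y) hP.eq

theorem relIndex_self {P : E →L[ℂ] E} (hP : IsIdempotentElem P) : relIndex P P = 0 := by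
  refine linIndex_of_bijective ⟨fun x y h => ?_, fun y => ⟨y, ?_⟩⟩
  · have := congrArg Subtype.val h
    rw [coe_compress, coe_compress, apply_of_mem_range hP x.2, apply_of_mem_range hP y.2] at this
    exact Subtype.ext this
  · exact Subtype.ext (apply_of_mem_range hP y.2)

theorem relIndex_add_eq_finrank {P E₀ : E →L[ℂ] E} (hP : IsIdempotentElem P)
    (hE : IsIdempotentElem E₀) (h₁ : P * E₀ = 0) (h₂ : E₀ * P = 0) :
    relIndex (P + E₀) P = finrank ℂ E₀.range := by
  have h₁' : ∀ x, P (E₀ x) = 0 := fun x => congrArg (fun T : E →L[ℂ] E => T x) h₁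
  have h₂' : ∀ x, E₀ (P x) = 0 := fun x => congrArg (fun T : E →L[ℂ] E => T x) h₂
  have hs : Function.Surjective (compress (P + E₀) P) := by
    rintro ⟨_, z, rfl⟩
    have hz : P (P z) = P z := apply_of_mem_range hP ⟨z, rfl⟩
    refine ⟨⟨P z, P z, ?_⟩, Subtype.ext hz⟩
    change P (P z) + E₀ (P z) = P z
    rw [h₂', add_zero, hz]
  have hk : (LinearMap.ker (compress (P + E₀) P)).map (P + E₀).range.subtype = E₀.range := by
    ext x
    constructor
    · rintro ⟨⟨_, z, rfl⟩, hx, rfl⟩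
      have hx' : P (P z + E₀ z) = 0 := congrArg Subtype.val (LinearMap.mem_ker.1 hx)
      have hz : P (P z) = P z := apply_of_mem_range hP ⟨z, rfl⟩
      rw [map_add, h₁', add_zero, hz] at hx'
      refine ⟨z, ?_⟩
      change E₀ z = P z + E₀ z
      rw [hx', zero_add]
    · rintro ⟨z, rfl⟩
      have hz : E₀ (E₀ z) = E₀ z := apply_of_mem_range hE ⟨z, rfl⟩
      refine ⟨⟨E₀ z, E₀ z, ?_⟩, ?_, rfl⟩
      · change P (E₀ z) + E₀ (E₀ z) = E₀ z
        rw [h₁', zero_add, hz]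
      · exact LinearMap.mem_ker.2 (Subtype.ext (h₁' z))
  rw [relIndex, linIndex_of_surjective hs, ← hk, Submodule.finrank_map_subtype_eq]

theorem compress_injective {P Q : E →L[ℂ] E} (hP : IsIdempotentElem P) (h : ‖P - Q‖ < 1) :
    Function.Injective (compress P Q) := by
  rw [injective_iff_map_eq_zero]
  intro x hx
  have h₁ : Q x = 0 := congrArg Subtype.val hx
  have h₂ := (P - Q).le_opNorm x
  rw [_root_.sub_apply, h₁, sub_zero, apply_of_mem_range hP x.2] at h₂
  have h₃ : ‖(x : E)‖ = 0 := by nlinarith [norm_nonneg (x : E)]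
  exact Subtype.ext (norm_eq_zero.1 h₃)

theorem finrank_range_eq_of_norm_sub_lt_one {P Q : E →L[ℂ] E} (hP : IsIdempotentElem P)
    (hQ : IsIdempotentElem Q) (fP : FiniteDimensional ℂ P.range) (fQ : FiniteDimensional ℂ Q.range)
    (h : ‖P - Q‖ < 1) : finrank ℂ P.range = finrank ℂ Q.range :=
  le_antisymm (LinearMap.finrank_le_finrank_of_injective (compress_injective hP h))
    (LinearMap.finrank_le_finrank_of_injective
      (compress_injective hQ (by rwa [norm_sub_rev])))

/-- Cyclicity of the trace for the inclusion ran T → W and T : W → ran T. It lets traces of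
operators with different ranges be compared on one common space. -/
theorem finRankTrace_eq_trace_restrict {T : E →L[ℂ] E} {W : Submodule ℂ E}
    [FiniteDimensional ℂ W] (hT : T.range ≤ W) :
    finRankTrace T = LinearMap.trace ℂ W
      (T.toLinearMap.restrict (fun x _ => hT ⟨x, rfl⟩ : ∀ x ∈ W, T.toLinearMap x ∈ W)) := by
  have : FiniteDimensional ℂ T.range := Submodule.finiteDimensional_of_le hT
  exact LinearMap.trace_comp_comm' (Submodule.inclusion hT)
    (T.toLinearMap.rangeRestrict ∘ₗ W.subtype)

theorem finRankTrace_of_isIdempotentElem {P : E →L[ℂ] E} (hP : IsIdempotentElem P)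
    (hf : FiniteDimensional ℂ P.range) : finRankTrace P = finrank ℂ P.range := by
  rw [← LinearMap.trace_id, finRankTrace]
  congr 1
  ext x
  exact apply_of_mem_range hP x.2

theorem finRankTrace_sub {S T : E →L[ℂ] E} (hS : FiniteDimensional ℂ S.range)
    (hT : FiniteDimensional ℂ T.range) :
    finRankTrace (S - T) = finRankTrace S - finRankTrace T := by
  have h : (S - T).range ≤ S.range ⊔ T.range := by
    rintro _ ⟨x, rfl⟩
    exact Submodule.sub_mem _ (Submodule.mem_sup_left ⟨x, rfl⟩) (Submodule.mem_sup_right ⟨x, rfl⟩)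
  rw [finRankTrace_eq_trace_restrict h, finRankTrace_eq_trace_restrict (le_sup_left (b := T.range)),
    finRankTrace_eq_trace_restrict (le_sup_right (a := S.range)), ← map_sub]
  rfl

variable [CompleteSpace E]

/-- The range of an idempotent is closed, hence a Hilbert space on which `f` is the identity plus a
compact operator. -/
theorem hasFiniteIndex_of_compact_perturbation {P T : E →L[ℂ] E} (hP : IsIdempotentElem P)
    (hT : IsCompactOperator T) {f : P.range →ₗ[ℂ] P.range}
    (hf : ∀ x : P.range, (f x : E) = x + P (T x)) : HasFiniteIndex f ∧ linIndex f = 0 := by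
  have hcl : IsClosed (P.range : Set E) := ContinuousLinearMap.IsIdempotentElem.isClosed_range hP
  have : CompleteSpace P.range := hcl.completeSpace_coe
  let K : P.range →L[ℂ] P.range :=
    (P.codRestrict P.range fun x => ⟨x, rfl⟩) ∘L (T ∘L P.range.subtypeL)
  have hK : IsCompactOperator K :=
    (hT.comp_clm P.range.subtypeL).clm_comp (P.codRestrict P.range fun x => ⟨x, rfl⟩)
  have heq : f = (1 + K : P.range →L[ℂ] P.range).toLinearMap := by
    ext x
    exact hf x
  rw [heq]
  exact hasFiniteIndex_one_add_of_isCompactOperator hK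

theorem compress_comp_self {P Q : E →L[ℂ] E} (hP : IsIdempotentElem P)
    (h : IsCompactOperator (Q - P)) :
    HasFiniteIndex (compress Q P ∘ₗ compress P Q) ∧
      linIndex (compress Q P ∘ₗ compress P Q) = 0 := by
  refine hasFiniteIndex_of_compact_perturbation hP h fun x => ?_
  have hx := apply_of_mem_range hP x.2
  simp [hx]

theorem hasFiniteIndex_compress {P Q : E →L[ℂ] E} (hP : IsIdempotentElem P)
    (hQ : IsIdempotentElem Q) (h : IsCompactOperator (P - Q)) : HasFiniteIndex (compress P Q) :=
  .of_comp (compress_comp_self hP (isCompactOperator_sub_symm h)).1 (compress_comp_self hQ h).1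

/-- The relative index is additive for projections which differ by compact operators. -/
theorem relIndex_trans {P Q R : E →L[ℂ] E} (hP : IsIdempotentElem P) (hQ : IsIdempotentElem Q)
    (hR : IsIdempotentElem R) (hPQ : IsCompactOperator (P - Q)) (hQR : IsCompactOperator (Q - R)) :
    relIndex P R = relIndex P Q + relIndex Q R := by
  have hPR : IsCompactOperator (P - R) := by
    have := hPQ.add hQR
    rwa [← FunLike.coe_add, sub_add_sub_cancel] at this
  have fPQ := hasFiniteIndex_compress hP hQ hPQ
  have fQR := hasFiniteIndex_compress hQ hR hQR
  have fPR := hasFiniteIndex_compress hP hR hPR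
  have fRP := hasFiniteIndex_compress hR hP (isCompactOperator_sub_symm hPR)
  have h₁ := (compress_comp_self hP (isCompactOperator_sub_symm hPR)).2
  rw [linIndex_comp fRP fPR] at h₁
  have hT : IsCompactOperator (R * (Q - P) + (R - P) * P : E →L[ℂ] E) :=
    (isCompactOperator_mul_left (isCompactOperator_sub_symm hPQ) R).add
      (isCompactOperator_mul_right (isCompactOperator_sub_symm hPR) P)
  -- On ran P the round trip P R Q is 1 + P (R (Q - P) + (R - P) P). Comparing with the round trip P
  -- R, also of index zero, gives additivity.
  have h₂ : linIndex (compress R P ∘ₗ (compress Q R ∘ₗ compress P Q)) = 0 := by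
    refine (hasFiniteIndex_of_compact_perturbation hP hT fun x => ?_).2
    have hx := apply_of_mem_range hP x.2
    simp [hx]
  rw [linIndex_comp fRP (fQR.comp fPQ), linIndex_comp fQR fPQ] at h₂
  unfold relIndex
  omega

theorem relIndex_symm {P Q : E →L[ℂ] E} (hP : IsIdempotentElem P) (hQ : IsIdempotentElem Q)
    (h : IsCompactOperator (P - Q)) : relIndex Q P = -relIndex P Q := by
  have := relIndex_trans hP hQ hP h (isCompactOperator_sub_symm h)
  rw [relIndex_self hP] at this
  omega

/-- Both compressions are injective, so both relative indices are at most zero; they are also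
negatives of each other. -/
theorem relIndex_eq_zero_of_norm_sub_lt_one {P Q : E →L[ℂ] E} (hP : IsIdempotentElem P)
    (hQ : IsIdempotentElem Q) (h : IsCompactOperator (P - Q)) (hn : ‖P - Q‖ < 1) :
    relIndex P Q = 0 := by
  have h₁ := relIndex_symm hP hQ h
  have h₂ := linIndex_of_injective (compress_injective hP hn)
  have h₃ := linIndex_of_injective (compress_injective hQ (by rwa [norm_sub_rev]))
  unfold relIndex at *
  omega

/-- The relative index vanishes along norm continuous paths of projections. -/
theorem relIndex_eq_zero_of_continuousOn {X : Type*} [TopologicalSpace X] {s : Set X}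
    (hs : IsPreconnected s) {N : X → E →L[ℂ] E} (hN : ContinuousOn N s)
    (hp : ∀ x ∈ s, IsIdempotentElem (N x))
    (hc : ∀ x ∈ s, ∀ y ∈ s, IsCompactOperator (N x - N y)) {x y : X} (hx : x ∈ s) (hy : y ∈ s) :
    relIndex (N x) (N y) = 0 := by
  refine hs.induction₂ (fun x y => relIndex (N x) (N y) = 0) (fun x hx => ?_)
    (fun x y z hx hy hz h₁ h₂ => ?_) (fun x y hx hy h => ?_) hx hy
  · filter_upwards [hN x hx (Metric.ball_mem_nhds _ one_pos), self_mem_nhdsWithin] with y hy hys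
    refine relIndex_eq_zero_of_norm_sub_lt_one (hp x hx) (hp y hys) (hc x hx y hys) ?_
    rwa [Set.mem_preimage, mem_ball_iff_norm, norm_sub_rev] at hy
  · rw [relIndex_trans (hp x hx) (hp y hy) (hp z hz) (hc x hx y hy) (hc y hy z hz), h₁, h₂,
      add_zero]
  · rw [relIndex_symm (hp x hx) (hp y hy) (hc x hx y hy), h, neg_zero]

end Projections

/-! ### Spectral projections of elements of `SFHat H` -/

section SpectralProjections

variable {H : Type*} [NormedAddCommGroup H] [InnerProductSpace ℂ H]

theorem algebraMap_real_eq_smul (x : ℝ) :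
    algebraMap ℝ (H →L[ℂ] H) x = (x : ℂ) • (1 : H →L[ℂ] H) := by
  ext v
  simp [Algebra.algebraMap_eq_smul_one]

theorem isCompactOperator_aeval_sub {F G : H →L[ℂ] H} (h : IsCompactOperator (F - G))
    (p : Polynomial ℝ) :
    IsCompactOperator (Polynomial.aeval F p - Polynomial.aeval G p : H →L[ℂ] H) := by
  induction p using Polynomial.induction_on' with
  | add p q hp hq =>
    rw [map_add, map_add, add_sub_add_comm]
    exact hp.add hq
  | monomial n r =>
    rw [Polynomial.aeval_monomial, Polynomial.aeval_monomial, ← mul_sub]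
    refine isCompactOperator_mul_left ?_ _
    induction n with
    | zero =>
      rw [pow_zero, pow_zero, sub_self]
      exact isCompactOperator_zero
    | succ n ih =>
      have : F ^ (n + 1) - G ^ (n + 1) = F ^ n * (F - G) + (F ^ n - G ^ n) * G := by
        rw [pow_succ, pow_succ]
        noncomm_ring
      rw [this]
      exact (isCompactOperator_mul_left h _).add (isCompactOperator_mul_right ih _)

variable [CompleteSpace H]

theorem isFredholm_sub_of_mem_SFHat {F : H →L[ℂ] H} (hF : F ∈ SFHat H) {x : ℝ}
    (hx : x ∈ Set.Ioo (-1 : ℝ) 1) : (F - (x : ℂ) • (1 : H →L[ℂ] H)).IsFredholm := by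
  by_contra h
  have hmem : (x : ℂ) ∈ essSpectrum F := h
  rw [hF.2.2] at hmem
  rcases hmem with h | h
  · have : x = -1 := by exact_mod_cast h
    linarith [hx.1]
  · have : x = 1 := by exact_mod_cast Set.mem_singleton_iff.1 h
    linarith [hx.2]

/-- Points of `(-1,1)` are isolated in the spectrum of an element of `SFHat H`. -/
theorem exists_spectrum_isolated {F : H →L[ℂ] H} (hF : F ∈ SFHat H) {x : ℝ}
    (hx : x ∈ Set.Ioo (-1 : ℝ) 1) :
    ∃ δ > 0, ∀ y ∈ spectrum ℝ F, |y - x| < δ → y = x := by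
  obtain ⟨δ, hδ, h⟩ := isUnit_sub_of_isFredholm hF.1.1 (isFredholm_sub_of_mem_SFHat hF hx)
  refine ⟨δ, hδ, fun y hy hyx => ?_⟩
  by_contra hne
  rw [spectrum.mem_iff, IsUnit.sub_iff, algebraMap_real_eq_smul] at hy
  exact hy (h y hne hyx)

/-- The spectral projection `χ_(-∞,c](F)`. -/
def lowerProj (F : H →L[ℂ] H) (c : ℝ) : H →L[ℂ] H :=
  cfc ((Set.Iic c).indicator (fun _ => (1 : ℝ))) F

theorem continuousOn_indicator_Iic {F : H →L[ℂ] H} (hF : F ∈ SFHat H) {c : ℝ}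
    (hc : c ∈ Set.Ioo (-1 : ℝ) 1) :
    ContinuousOn ((Set.Iic c).indicator (fun _ => (1 : ℝ))) (spectrum ℝ F) := by
  intro x hx
  rcases lt_trichotomy x c with h | rfl | h
  · refine ContinuousAt.continuousWithinAt ((continuousAt_const (y := (1 : ℝ))).congr ?_)
    filter_upwards [Iio_mem_nhds h] with y hy
    simp [Set.indicator, (Set.mem_Iio.1 hy).le]
  · obtain ⟨δ, hδ, hi⟩ := exists_spectrum_isolated hF hc
    refine ContinuousWithinAt.congr_of_eventuallyEq
      (continuousWithinAt_const (b := (Set.Iic x).indicator (fun _ => (1 : ℝ)) x)) ?_ rfl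
    filter_upwards [self_mem_nhdsWithin, mem_nhdsWithin_of_mem_nhds (Metric.ball_mem_nhds x hδ)]
      with y hy hyb
    rw [hi y hy (by simpa [Real.dist_eq] using hyb)]
  · refine ContinuousAt.continuousWithinAt ((continuousAt_const (y := (0 : ℝ))).congr ?_)
    filter_upwards [Ioi_mem_nhds h] with y hy
    simp [Set.indicator, Set.mem_Ioi.1 hy]

theorem lowerProj_mul_lowerProj {F : H →L[ℂ] H} (hF : F ∈ SFHat H) {c d : ℝ}
    (hc : c ∈ Set.Ioo (-1 : ℝ) 1) (hd : d ∈ Set.Ioo (-1 : ℝ) 1) :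
    lowerProj F c * lowerProj F d = lowerProj F (min c d) := by
  rw [lowerProj, lowerProj, ← cfc_mul _ _ F (continuousOn_indicator_Iic hF hc)
    (continuousOn_indicator_Iic hF hd), lowerProj]
  congr 1
  ext x
  by_cases h₁ : x ≤ c <;> by_cases h₂ : x ≤ d <;> simp [Set.indicator, h₁, h₂]

theorem isIdempotentElem_lowerProj {F : H →L[ℂ] H} (hF : F ∈ SFHat H) {c : ℝ}
    (hc : c ∈ Set.Ioo (-1 : ℝ) 1) : IsIdempotentElem (lowerProj F c) := by
  rw [IsIdempotentElem, lowerProj_mul_lowerProj hF hc hc, min_self]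

theorem specProj_eq_sub {F : H →L[ℂ] H} (hF : F ∈ SFHat H) {a b : ℝ}
    (ha : a ∈ Set.Ioo (-1 : ℝ) 1) (hb : b ∈ Set.Ioo (-1 : ℝ) 1) (hab : a ≤ b) :
    specProj F a b = lowerProj F b - lowerProj F a := by
  rw [lowerProj, lowerProj, ← cfc_sub _ _ F (continuousOn_indicator_Iic hF hb)
    (continuousOn_indicator_Iic hF ha), specProj]
  congr 1
  ext x
  by_cases h₁ : x ≤ a
  · simp [Set.indicator, h₁, h₁.trans hab]
  · simp [Set.indicator, h₁, not_le.1 h₁]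

theorem isIdempotentElem_specProj {F : H →L[ℂ] H} (hF : F ∈ SFHat H) {a b : ℝ}
    (ha : a ∈ Set.Ioo (-1 : ℝ) 1) (hb : b ∈ Set.Ioo (-1 : ℝ) 1) :
    IsIdempotentElem (specProj F a b) := by
  have hc := continuousOn_indicator_spectrum hF ha.1 hb.2
  rw [IsIdempotentElem, specProj, ← cfc_mul _ _ F hc hc]
  congr 1
  ext x
  simp [Set.indicator]

/-- For levels x, y close together only the spectral point x can lie between them, so the range lies
in ker (F - x), which is finite-dimensional. Connectedness of (-1,1) extends this to all pairs of
levels. -/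
theorem finiteDimensional_range_lowerProj_sub {F : H →L[ℂ] H} (hF : F ∈ SFHat H) {c d : ℝ}
    (hc : c ∈ Set.Ioo (-1 : ℝ) 1) (hd : d ∈ Set.Ioo (-1 : ℝ) 1) :
    FiniteDimensional ℂ (lowerProj F c - lowerProj F d).range := by
  refine isPreconnected_Ioo.induction₂
    (fun c d => FiniteDimensional ℂ (lowerProj F c - lowerProj F d).range)
    (fun x hx => ?_) (fun x y z _ _ _ h₁ h₂ => ?_) (fun x y _ _ h => ?_) hc hd
  · obtain ⟨δ, hδ, hi⟩ := exists_spectrum_isolated hF hx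
    filter_upwards [self_mem_nhdsWithin, mem_nhdsWithin_of_mem_nhds (Metric.ball_mem_nhds x hδ)]
      with y hy hyb
    rw [Metric.mem_ball, Real.dist_eq, abs_lt] at hyb
    have hsa : IsSelfAdjoint F := hF.1.1
    have hcx := continuousOn_indicator_Iic hF hx
    have hcy := continuousOn_indicator_Iic hF hy
    have hFx : F - (x : ℂ) • (1 : H →L[ℂ] H) = cfc (fun t : ℝ => t - x) F := by
      rw [cfc_sub (fun t : ℝ => t) (fun _ => x) F, cfc_id' ℝ F, cfc_const x F,
        algebraMap_real_eq_smul]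
    have hzero : (F - (x : ℂ) • (1 : H →L[ℂ] H)) * (lowerProj F x - lowerProj F y) = 0 := by
      rw [hFx, lowerProj, lowerProj, ← cfc_sub _ _ F hcx hcy,
        ← cfc_mul (fun t : ℝ => t - x)
        (fun t => (Set.Iic x).indicator (fun _ => (1 : ℝ)) t -
          (Set.Iic y).indicator (fun _ => (1 : ℝ)) t) F (by fun_prop) (hcx.sub hcy)]
      conv_rhs => rw [← cfc_const_zero ℝ F]
      refine cfc_congr fun t ht => ?_
      by_cases htx : t = x
      · simp [htx]
      · have hdist : δ ≤ |t - x| := by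
          by_contra hlt
          exact htx (hi t ht (not_le.1 hlt))
        have hiff : t ≤ x ↔ t ≤ y := by
          rcases le_abs.1 hdist with h | h
          · exact ⟨fun _ => by linarith, fun _ => by linarith⟩
          · exact ⟨fun _ => by linarith, fun _ => by linarith⟩
        simp [Set.indicator, hiff]
    have hfr := (isFredholm_sub_of_mem_SFHat hF hx).finite_ker
    refine Submodule.finiteDimensional_of_le
      (S₂ := (F - (x : ℂ) • (1 : H →L[ℂ] H)).ker) ?_
    rintro _ ⟨v, rfl⟩
    exact congrArg (fun T : H →L[ℂ] H => T v) hzero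
  · refine Submodule.finiteDimensional_of_le
      (S₂ := (lowerProj F x - lowerProj F y).range ⊔ (lowerProj F y - lowerProj F z).range) ?_
    rintro _ ⟨v, rfl⟩
    refine Submodule.mem_sup.2 ⟨_, ⟨v, rfl⟩, _, ⟨v, rfl⟩, ?_⟩
    simp
  · rw [← neg_sub]
    refine Submodule.finiteDimensional_of_le (S₂ := (lowerProj F x - lowerProj F y).range) ?_
    rintro _ ⟨v, rfl⟩
    exact ⟨-v, by simp [neg_add_eq_sub]⟩

theorem finiteDimensional_range_specProj {F : H →L[ℂ] H} (hF : F ∈ SFHat H) {a b : ℝ}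
    (ha : a ∈ Set.Ioo (-1 : ℝ) 1) (hb : b ∈ Set.Ioo (-1 : ℝ) 1) (hab : a ≤ b) :
    FiniteDimensional ℂ (specProj F a b).range := by
  rw [specProj_eq_sub hF ha hb hab]
  exact finiteDimensional_range_lowerProj_sub hF hb ha

/-- Continuous functional calculus preserves compactness of differences. -/
theorem isCompactOperator_cfc_sub {F G : H →L[ℂ] H} (hF : IsSelfAdjoint F) (hG : IsSelfAdjoint G)
    (h : IsCompactOperator (F - G)) {f : ℝ → ℝ} (hf : Continuous f) :
    IsCompactOperator (cfc f F - cfc f G : H →L[ℂ] H) := by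
  -- Both spectra lie in [-M, M], where `f` is a uniform limit of polynomials; compact operators are
  -- norm closed. The factor ‖1‖ covers the zero space.
  set M := max (‖F‖ * ‖(1 : H →L[ℂ] H)‖) (‖G‖ * ‖(1 : H →L[ℂ] H)‖)
  have approx : ∀ {p : Polynomial ℝ} {ε : ℝ}, 0 < ε →
      (∀ x ∈ Set.Icc (-M) M, |p.eval x - f x| < ε) → ∀ T : H →L[ℂ] H, IsSelfAdjoint T →
      ‖T‖ * ‖(1 : H →L[ℂ] H)‖ ≤ M → ‖cfc f T - Polynomial.aeval T p‖ ≤ ε := by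
    intro p ε hε hp T hT hTM
    rw [← cfc_polynomial p T, ← cfc_sub f p.eval T hf.continuousOn p.continuousOn]
    refine norm_cfc_le hε.le fun x hx => ?_
    have hxM : |x| ≤ M := (spectrum.norm_le_norm_mul_of_mem hx).trans hTM
    rw [norm_sub_rev]
    exact (hp x (abs_le.1 hxM)).le
  refine (isClosed_setOfPred_isCompactOperator (𝕜₂ := ℂ) (σ₁₂ := RingHom.id ℂ)
    (M₁ := H) (M₂ := H)).closure_subset_iff.2 subset_rfl (Metric.mem_closure_iff.2 fun ε hε => ?_)
  obtain ⟨p, hp⟩ := exists_polynomial_near_of_continuousOn (-M) M f hf.continuousOn (ε / 3)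
    (by positivity)
  refine ⟨_, isCompactOperator_aeval_sub h p, ?_⟩
  have h₁ := approx (by positivity) hp F hF (le_max_left _ _)
  have h₂ := approx (by positivity) hp G hG (le_max_right _ _)
  rw [dist_eq_norm, sub_sub_sub_comm]
  refine (norm_sub_le _ _).trans_lt ?_
  linarith

theorem isCompactOperator_lowerProj_sub {F G : H →L[ℂ] H} (hF : F ∈ SFHat H) (hG : G ∈ SFHat H)
    (h : IsCompactOperator (F - G)) {c : ℝ} (hc : c ∈ Set.Ioo (-1 : ℝ) 1) :
    IsCompactOperator (lowerProj F c - lowerProj G c : H →L[ℂ] H) := by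
  obtain ⟨δ₁, hδ₁, h₁⟩ := exists_spectrum_isolated hF hc
  obtain ⟨δ₂, hδ₂, h₂⟩ := exists_spectrum_isolated hG hc
  set δ := min δ₁ δ₂
  have hδ : 0 < δ := lt_min hδ₁ hδ₂
  -- A ramp from 1 at c to 0 at c + δ. Neither spectrum meets (c, c + δ), so on both it equals the
  -- indicator of (-∞,c].
  set f : ℝ → ℝ := fun x => max 0 (min 1 ((c + δ - x) / δ)) with hf
  have key : ∀ T : H →L[ℂ] H, (∀ y ∈ spectrum ℝ T, |y - c| < δ → y = c) →
      lowerProj T c = cfc f T := by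
    intro T hT
    refine cfc_congr fun x hx => ?_
    by_cases hxc : x ≤ c
    · have : 1 ≤ (c + δ - x) / δ := by rw [le_div_iff₀ hδ]; linarith
      simp [Set.indicator, hxc, hf, this]
    · have hd : δ ≤ x - c := by
        by_contra hlt
        refine hxc (hT x hx ?_).le
        rw [abs_of_pos (by linarith)]
        linarith
      have : (c + δ - x) / δ ≤ 0 := div_nonpos_of_nonpos_of_nonneg (by linarith) hδ.le
      simp [Set.indicator, hxc, hf, this]
  rw [key F fun y hy hyc => h₁ y hy (hyc.trans_le (min_le_left _ _)),
    key G fun y hy hyc => h₂ y hy (hyc.trans_le (min_le_right _ _))]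
  exact isCompactOperator_cfc_sub hF.1.1 hG.1.1 h (by fun_prop)

end SpectralProjections

/-! ### Spectral flow along paths -/

section Paths

variable {H : Type*} [NormedAddCommGroup H] [InnerProductSpace ℂ H]

theorem finrank_eq_of_continuousOn {X : Type*} [TopologicalSpace X] {s : Set X}
    (hs : IsPreconnected s) {N : X → H →L[ℂ] H} (hN : ContinuousOn N s)
    (hp : ∀ x ∈ s, IsIdempotentElem (N x)) (hf : ∀ x ∈ s, FiniteDimensional ℂ (N x).range)
    {x y : X} (hx : x ∈ s) (hy : y ∈ s) : finrank ℂ (N x).range = finrank ℂ (N y).range := by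
  refine hs.induction₂ (fun x y => finrank ℂ (N x).range = finrank ℂ (N y).range) (fun x hx => ?_)
    (fun x y z _ _ _ h₁ h₂ => h₁.trans h₂) (fun x y _ _ h => h.symm) hx hy
  filter_upwards [hN x hx (Metric.ball_mem_nhds _ one_pos), self_mem_nhdsWithin] with y hy hys
  refine finrank_range_eq_of_norm_sub_lt_one (hp x hx) (hp y hys) (hf x hx) (hf y hys) ?_
  rwa [Set.mem_preimage, mem_ball_iff_norm, norm_sub_rev] at hy

variable [CompleteSpace H]

theorem continuousOn_one_sub_indicator_mul {F : H →L[ℂ] H} (hF : F ∈ SFHat H) {a b : ℝ}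
    (ha : -1 < a) (hb : b < 1) :
    ContinuousOn (fun t : ℝ => (1 - (Set.Ioc a b).indicator (fun _ => (1 : ℝ)) t) * t)
      (spectrum ℝ F) :=
  (continuousOn_const.sub (continuousOn_indicator_spectrum hF ha hb)).mul continuousOn_id

theorem one_sub_specProj_mul {F : H →L[ℂ] H} (hF : F ∈ SFHat H) {a b : ℝ} (ha : -1 < a)
    (hb : b < 1) : (1 - specProj F a b) * F =
      cfc (fun t : ℝ => (1 - (Set.Ioc a b).indicator (fun _ => (1 : ℝ)) t) * t) F := by
  have hsa : IsSelfAdjoint F := hF.1.1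
  have hc := continuousOn_indicator_spectrum hF ha hb
  rw [cfc_mul (fun t : ℝ => 1 - (Set.Ioc a b).indicator (fun _ => (1 : ℝ)) t) (fun t => t) F
    (continuousOn_const.sub hc) continuousOn_id,
    cfc_sub (fun _ : ℝ => (1 : ℝ)) (fun t => (Set.Ioc a b).indicator (fun _ => (1 : ℝ)) t) F
    continuousOn_const hc, cfc_const_one ℝ F, cfc_id' ℝ F]
  rfl

/-- Multiplying by 1 - χ_(a,b](F) moves the spectrum in (a,b] to 0 and opens a gap between a and 0,
so one continuous ramp serves every F. A spectral partition does not keep `a` out of the spectrum;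
continuity of χ_(a,b] alone thus yields continuity of the lower projection. -/
theorem lowerProj_eq_cfc_one_sub_specProj_mul {F : H →L[ℂ] H} (hF : F ∈ SFHat H) {a b : ℝ}
    (ha : a ∈ Set.Ioo (-1 : ℝ) 0) (hb : b ∈ Set.Ioo (0 : ℝ) 1) :
    lowerProj F a = cfc (fun x : ℝ => max 0 (min 1 (x / a))) ((1 - specProj F a b) * F) := by
  have hsa : IsSelfAdjoint F := hF.1.1
  rw [one_sub_specProj_mul hF ha.1 hb.2, ← cfc_comp' (fun x : ℝ => max 0 (min 1 (x / a))) _ F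
    (Continuous.continuousOn (by fun_prop)) (continuousOn_one_sub_indicator_mul hF ha.1 hb.2),
    lowerProj]
  congr 1
  ext x
  by_cases h₁ : x ≤ a
  · have : 1 ≤ x / a := (one_le_div_of_neg ha.2).2 h₁
    simp [Set.indicator, h₁, this, not_lt.2 h₁]
  · by_cases h₂ : x ≤ b
    · simp [Set.indicator, h₁, h₂, not_le.1 h₁]
    · have : x / a ≤ 0 := div_nonpos_of_nonneg_of_nonpos (by linarith [hb.1]) ha.2.le
      simp [Set.indicator, h₁, h₂, this]

theorem continuousOn_lowerProj {X : Type*} [TopologicalSpace X] {s : Set X} {γ : X → H →L[ℂ] H}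
    (hγ : ContinuousOn γ s) (hF : ∀ x ∈ s, γ x ∈ SFHat H) {a b : ℝ}
    (ha : a ∈ Set.Ioo (-1 : ℝ) 0) (hb : b ∈ Set.Ioo (0 : ℝ) 1)
    (hq : ContinuousOn (fun x => specProj (γ x) a b) s) :
    ContinuousOn (fun x => lowerProj (γ x) a) s := by
  refine ContinuousOn.congr (f := fun x => cfc (fun x : ℝ => max 0 (min 1 (x / a)))
    ((1 - specProj (γ x) a b) * γ x)) ?_
    fun x hx => lowerProj_eq_cfc_one_sub_specProj_mul (hF x hx) ha hb
  refine ContinuousOn.cfc_of_mem_nhdsSet (s := Set.univ) _ Filter.univ_mem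
    ((continuousOn_const.sub hq).mul hγ) (fun x hx => ?_) (Continuous.continuousOn (by fun_prop))
  rw [one_sub_specProj_mul (hF x hx) ha.1 hb.2]
  exact cfc_predicate _ (γ x)

theorem lowerProj_zero_eq_add {F : H →L[ℂ] H} (hF : F ∈ SFHat H) {a : ℝ}
    (ha : a ∈ Set.Ioo (-1 : ℝ) 0) : lowerProj F 0 = lowerProj F a + specProj F a 0 := by
  rw [specProj_eq_sub hF ⟨ha.1, ha.2.trans one_pos⟩ (by simp) ha.2.le, add_sub_cancel]

theorem relIndex_lowerProj_eq_finrank {F : H →L[ℂ] H} (hF : F ∈ SFHat H) {a : ℝ}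
    (ha : a ∈ Set.Ioo (-1 : ℝ) 0) :
    relIndex (lowerProj F 0) (lowerProj F a) = finrank ℂ (specProj F a 0).range := by
  have ha' : a ∈ Set.Ioo (-1 : ℝ) 1 := ⟨ha.1, ha.2.trans one_pos⟩
  have h0 : (0 : ℝ) ∈ Set.Ioo (-1 : ℝ) 1 := by simp
  have hP := isIdempotentElem_lowerProj hF ha'
  rw [lowerProj_zero_eq_add hF ha]
  refine relIndex_add_eq_finrank hP (isIdempotentElem_specProj hF ha' h0) ?_ ?_
  · rw [specProj_eq_sub hF ha' h0 ha.2.le, mul_sub, lowerProj_mul_lowerProj hF ha' h0,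
      min_eq_left ha.2.le, hP.eq, sub_self]
  · rw [specProj_eq_sub hF ha' h0 ha.2.le, sub_mul, lowerProj_mul_lowerProj hF h0 ha',
      min_eq_right ha.2.le, hP.eq, sub_self]

/-- On an interval of a spectral partition, the trace which defines the spectral flow is the
relative index of the spectral projections at the end points. -/
theorem finRankTrace_specProj_sub {X : Type*} [TopologicalSpace X] {s : Set X}
    (hs : IsPreconnected s) {γ : X → H →L[ℂ] H} (hγ : ContinuousOn γ s)
    (hF : ∀ x ∈ s, γ x ∈ SFHat H) (hc : ∀ x ∈ s, ∀ y ∈ s, IsCompactOperator (γ x - γ y)) {a b : ℝ}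
    (ha : a ∈ Set.Ioo (-1 : ℝ) 0) (hb : b ∈ Set.Ioo (0 : ℝ) 1)
    (hq : ContinuousOn (fun x => specProj (γ x) a b) s) {x y : X} (hx : x ∈ s) (hy : y ∈ s) :
    finRankTrace (specProj (γ x) a 0 - specProj (γ y) a 0) =
      (relIndex (lowerProj (γ x) 0) (lowerProj (γ y) 0) : ℂ) := by
  have ha' : a ∈ Set.Ioo (-1 : ℝ) 1 := ⟨ha.1, ha.2.trans one_pos⟩
  have h0 : (0 : ℝ) ∈ Set.Ioo (-1 : ℝ) 1 := by simp
  have hfd : ∀ z ∈ s, FiniteDimensional ℂ (specProj (γ z) a 0).range := fun z hz =>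
    finiteDimensional_range_specProj (hF z hz) ha' h0 ha.2.le
  have hcomp : ∀ z ∈ s, IsCompactOperator (lowerProj (γ z) 0 - lowerProj (γ z) a : H →L[ℂ] H) :=
    fun z hz => isCompactOperator_of_finiteDimensional_range
      (finiteDimensional_range_lowerProj_sub (hF z hz) h0 ha')
  have hpa : ∀ z ∈ s, IsIdempotentElem (lowerProj (γ z) a) := fun z hz =>
    isIdempotentElem_lowerProj (hF z hz) ha'
  have hp0 : ∀ z ∈ s, IsIdempotentElem (lowerProj (γ z) 0) := fun z hz =>
    isIdempotentElem_lowerProj (hF z hz) h0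
  have hca : ∀ z ∈ s, ∀ w ∈ s, IsCompactOperator (lowerProj (γ z) a - lowerProj (γ w) a :
      H →L[ℂ] H) := fun z hz w hw =>
    isCompactOperator_lowerProj_sub (hF z hz) (hF w hw) (hc z hz w hw) ha'
  -- At level `a` nothing flows. Going from level 0 down to `a` at x, across to y, and back up to 0
  -- leaves the difference of the ranks of χ_(a,0].
  have hcon := relIndex_eq_zero_of_continuousOn hs (continuousOn_lowerProj hγ hF ha hb hq) hpa hca
    hx hy
  have hya := isCompactOperator_sub_symm (hcomp y hy)
  have h₁ := relIndex_trans (hp0 x hx) (hpa x hx) (hpa y hy) (hcomp x hx) (hca x hx y hy)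
  have hc' : IsCompactOperator (lowerProj (γ x) 0 - lowerProj (γ y) a : H →L[ℂ] H) := by
    have := (hcomp x hx).add (hca x hx y hy)
    rwa [← FunLike.coe_add, sub_add_sub_cancel] at this
  have h₂ := relIndex_trans (hp0 x hx) (hpa y hy) (hp0 y hy) hc' hya
  rw [h₂, h₁, hcon, relIndex_symm (hp0 y hy) (hpa y hy) (hcomp y hy),
    relIndex_lowerProj_eq_finrank (hF x hx) ha, relIndex_lowerProj_eq_finrank (hF y hy) ha,
    finRankTrace_sub (hfd x hx) (hfd y hy),
    finRankTrace_of_isIdempotentElem (isIdempotentElem_specProj (hF x hx) ha' h0) (hfd x hx),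
    finRankTrace_of_isIdempotentElem (isIdempotentElem_specProj (hF y hy) ha' h0) (hfd y hy)]
  push_cast
  ring

/-- The spectral flow is the relative index of the spectral projections at the end points. -/
theorem flow_eq_relIndex {γ : C(unitInterval, H →L[ℂ] H)} (hF : ∀ t, γ t ∈ SFHat H)
    (hc : ∀ s t, IsCompactOperator (γ s - γ t)) (D : SpectralPartition γ) :
    D.flow = (relIndex (lowerProj (γ 0) 0) (lowerProj (γ 1) 0) : ℂ) := by
  have h0 : (0 : ℝ) ∈ Set.Ioo (-1 : ℝ) 1 := by simp
  have hp : ∀ t, IsIdempotentElem (lowerProj (γ t) 0) := fun t =>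
    isIdempotentElem_lowerProj (hF t) h0
  have hcp : ∀ s t, IsCompactOperator (lowerProj (γ s) 0 - lowerProj (γ t) 0 : H →L[ℂ] H) :=
    fun s t => isCompactOperator_lowerProj_sub (hF s) (hF t) (hc s t) h0
  -- The relative index from time 0 to time s_n; the trace on each interval is an increment of `g`.
  set g : Fin (D.N + 1) → ℂ := fun n =>
    (relIndex (lowerProj (γ 0) 0) (lowerProj (γ (D.s n)) 0) : ℂ) with hg
  have hterm : ∀ n : Fin D.N, finRankTrace (specProj (γ (D.s n.castSucc)) (D.a n) 0 -
      specProj (γ (D.s n.succ)) (D.a n) 0) = g n.succ - g n.castSucc := by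
    intro n
    have hle : D.s n.castSucc ≤ D.s n.succ := D.strictMono_s.monotone n.castSucc_lt_succ.le
    rw [finRankTrace_specProj_sub isPreconnected_Icc γ.continuous.continuousOn (fun t _ => hF t)
      (fun s _ t _ => hc s t) (D.a_mem n) (D.b_mem n) (D.continuousOn_proj n)
      (Set.left_mem_Icc.2 hle) (Set.right_mem_Icc.2 hle), hg]
    simp only
    rw [relIndex_trans (hp 0) (hp (D.s n.castSucc)) (hp (D.s n.succ)) (hcp _ _) (hcp _ _)]
    push_cast
    ring
  have h₁ := Fin.sum_univ_succ g
  have h₂ := Fin.sum_univ_castSucc g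
  rw [SpectralPartition.flow, Finset.sum_congr rfl fun n _ => hterm n, Finset.sum_sub_distrib]
  have hz : g 0 = 0 := by
    simp [hg, D.s_zero, relIndex_self (hp 0)]
  have hl : g (Fin.last D.N) = (relIndex (lowerProj (γ 0) 0) (lowerProj (γ 1) 0) : ℂ) := by
    simp [hg, D.s_last]
  linear_combination h₂ - h₁ - hz + hl

theorem isOpen_setOf_notMem_spectrum {X : Type*} [TopologicalSpace X] {γ : X → H →L[ℂ] H}
    (hγ : Continuous γ) (c : ℝ) : IsOpen {x | c ∉ spectrum ℝ (γ x)} := by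
  have : {x | c ∉ spectrum ℝ (γ x)} =
      (fun x => algebraMap ℝ (H →L[ℂ] H) c - γ x) ⁻¹' {T | IsUnit T} := by
    ext x
    simp [spectrum.mem_iff]
  rw [this]
  exact Units.isOpen.preimage (continuous_const.sub hγ)

/-- The indicator of (a,b] is continuous off {a, b}, an open set containing all the spectra
involved. -/
theorem continuousOn_specProj {X : Type*} [TopologicalSpace X] {γ : X → H →L[ℂ] H}
    (hγ : Continuous γ) (hsa : ∀ x, IsSelfAdjoint (γ x)) (a b : ℝ) :
    ContinuousOn (fun x => specProj (γ x) a b)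
      {x | a ∉ spectrum ℝ (γ x) ∧ b ∉ spectrum ℝ (γ x)} := by
  have hopen : IsOpen ({a, b}ᶜ : Set ℝ) := (Set.toFinite {a, b}).isClosed.isOpen_compl
  refine ContinuousOn.cfc_of_mem_nhdsSet (s := {a, b}ᶜ) _ (hopen.mem_nhdsSet.2 ?_)
    hγ.continuousOn (fun x _ => hsa x) ?_
  · refine Set.iUnion₂_subset fun x hx y hy hyab => ?_
    rcases hyab with rfl | rfl
    · exact hx.1 hy
    · exact hx.2 hy
  · intro x hx
    rw [Set.mem_compl_iff, Set.mem_insert_iff, Set.mem_singleton_iff, not_or] at hx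
    refine ContinuousAt.continuousWithinAt ((continuousAt_const
      (y := (Set.Ioc a b).indicator (fun _ => (1 : ℝ)) x)).congr ?_)
    have h₁ : ∀ᶠ y in nhds x, (a < y ↔ a < x) := by
      rcases lt_or_gt_of_ne hx.1 with h | h
      · filter_upwards [Iio_mem_nhds h] with y hy
        exact iff_of_false (not_lt.2 (Set.mem_Iio.1 hy).le) (not_lt.2 h.le)
      · filter_upwards [Ioi_mem_nhds h] with y hy
        exact iff_of_true hy h
    have h₂ : ∀ᶠ y in nhds x, (y ≤ b ↔ x ≤ b) := by
      rcases lt_or_gt_of_ne hx.2 with h | h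
      · filter_upwards [Iio_mem_nhds h] with y hy
        exact iff_of_true (Set.mem_Iio.1 hy).le h.le
      · filter_upwards [Ioi_mem_nhds h] with y hy
        exact iff_of_false (not_le.2 hy) (not_le.2 h)
    filter_upwards [h₁, h₂] with y h₁ h₂
    simp [Set.indicator, h₁, h₂]

theorem exists_gap {F : H →L[ℂ] H} (hF : F ∈ SFHat H) :
    ∃ a ∈ Set.Ioo (-1 : ℝ) 0, ∃ b ∈ Set.Ioo (0 : ℝ) 1, a ∉ spectrum ℝ F ∧ b ∉ spectrum ℝ F := by
  obtain ⟨δ, hδ, h⟩ := exists_spectrum_isolated hF (x := 0) (by simp)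
  set ε := min δ 1 / 2 with hε
  have h₁ : 0 < ε := by positivity
  have h₂ : ε < δ := by
    have := min_le_left δ 1
    linarith
  have h₃ : ε < 1 := by
    have := min_le_right δ 1
    linarith
  refine ⟨-ε, ⟨by linarith, by linarith⟩, ε, ⟨h₁, h₃⟩, fun hm => ?_, fun hm => ?_⟩
  · have := h _ hm (by rwa [sub_zero, abs_neg, abs_of_pos h₁])
    linarith
  · have := h _ hm (by rwa [sub_zero, abs_of_pos h₁])
    linarith

theorem nonempty_spectralPartition {γ : C(unitInterval, H →L[ℂ] H)} (hF : ∀ t, γ t ∈ SFHat H) :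
    Nonempty (SpectralPartition γ) := by
  choose a ha b hb hab using fun t => exists_gap (hF t)
  let c : unitInterval → Set unitInterval := fun i =>
    {t | a i ∉ spectrum ℝ (γ t) ∧ b i ∉ spectrum ℝ (γ t)}
  obtain ⟨δ, hδ, hball⟩ := lebesgue_number_lemma_of_metric (c := c) isCompact_univ
    (fun i => (isOpen_setOf_notMem_spectrum γ.continuous (a i)).inter
      (isOpen_setOf_notMem_spectrum γ.continuous (b i)))
    (fun t _ => Set.mem_iUnion.2 ⟨t, hab t⟩)
  choose i hi using fun t => hball t (Set.mem_univ t)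
  -- The m + 1 equal intervals are shorter than the Lebesgue number δ, so each lies in the ball
  -- about its left end point, where one gap pair works throughout.
  obtain ⟨m, hm⟩ := exists_nat_one_div_lt hδ
  have hm0 : (0 : ℝ) < m + 1 := by positivity
  let s : Fin (m + 1 + 1) → unitInterval := fun n => ⟨n / (m + 1), by positivity, by
    rw [div_le_one hm0]
    exact_mod_cast Nat.lt_succ_iff.1 n.2⟩
  have hsub : ∀ n : Fin (m + 1), Set.Icc (s n.castSucc) (s n.succ) ⊆ c (i (s n.castSucc)) := by
    intro n t ht
    refine hi _ ?_
    have h₁ : (s n.castSucc : ℝ) ≤ t := ht.1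
    have h₂ : (t : ℝ) ≤ s n.succ := ht.2
    have h₃ : (s n.succ : ℝ) = s n.castSucc + 1 / (m + 1) := by
      simp only [s, Fin.val_succ, Fin.val_castSucc]
      push_cast
      ring
    rw [Metric.mem_ball, Subtype.dist_eq, Real.dist_eq, abs_of_nonneg (by linarith)]
    linarith
  have hlt : ∀ i, a i ∈ Set.Ioo (-1 : ℝ) 1 ∧ b i ∈ Set.Ioo (-1 : ℝ) 1 ∧ a i ≤ b i := fun i =>
    ⟨⟨(ha i).1, (ha i).2.trans one_pos⟩, ⟨by linarith [(hb i).1], (hb i).2⟩,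
      ((ha i).2.trans (hb i).1).le⟩
  have hcont : ∀ n : Fin (m + 1), ContinuousOn
      (fun t => specProj (γ t) (a (i (s n.castSucc))) (b (i (s n.castSucc))))
      (Set.Icc (s n.castSucc) (s n.succ)) := fun n =>
    (continuousOn_specProj γ.continuous (fun t => (hF t).1.1) _ _).mono (hsub n)
  have hfin : ∀ (n : Fin (m + 1)) (t : unitInterval), FiniteDimensional ℂ
      (specProj (γ t) (a (i (s n.castSucc))) (b (i (s n.castSucc)))).range := fun n t =>
    finiteDimensional_range_specProj (hF t) (hlt _).1 (hlt _).2.1 (hlt _).2.2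
  have hmono : StrictMono s := fun j k hjk => by
    refine Subtype.mk_lt_mk.2 (div_lt_div_of_pos_right ?_ hm0)
    exact_mod_cast hjk
  exact ⟨{
    N := m + 1
    s := s
    a := fun n => a (i (s n.castSucc))
    b := fun n => b (i (s n.castSucc))
    strictMono_s := hmono
    s_zero := by simp [s]
    s_last := by
      refine Subtype.ext ?_
      simp only [s, Fin.val_last]
      push_cast
      exact div_self hm0.ne'
    a_mem := fun n => ha _
    b_mem := fun n => hb _
    continuousOn_proj := hcont
    finite_rank := fun n t _ => hfin n t
    constant_rank := fun n => ⟨_, fun t ht => finrank_eq_of_continuousOn isPreconnected_Icc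
      (hcont n) (fun t _ => isIdempotentElem_specProj (hF t) (hlt _).1 (hlt _).2.1)
      (fun t _ => hfin n t) ht
      (Set.left_mem_Icc.2 (hmono.monotone n.castSucc_lt_succ.le))⟩ }⟩

end Paths

/-! ### The set Θ(F,U) and the straight path -/

section Main

variable {H : Type*} [NormedAddCommGroup H] [InnerProductSpace ℂ H] [CompleteSpace H]

/-- The essential spectrum is unchanged, so it contains 1; hence 1 is in the spectrum and the norm
cannot drop below 1. -/
theorem mem_SFHat_of_isCompactOperator_sub {F G : H →L[ℂ] H} (hF : F ∈ SFHat H)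
    (hG : IsSelfAdjoint G) (hn : ‖G‖ ≤ 1) (hc : IsCompactOperator (G - F)) : G ∈ SFHat H := by
  have hess : essSpectrum G = {-1, 1} := by
    rw [essSpectrum_eq_of_isCompactOperator_sub hc, hF.2.2]
  have h1 : (1 : ℂ) ∈ essSpectrum G := by simp [hess]
  refine ⟨⟨hG, isFredholm_of_isCompactOperator_sub hF.1.2.1 hc, ⟨1, one_pos, by simpa using h1⟩,
    ⟨-1, by norm_num, by simp [hess]⟩⟩, le_antisymm hn ?_, hess⟩
  -- The bound of spectral values by the norm needs ‖1‖ = 1; the zero space is excluded by ‖F‖ = 1.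
  have hne : Nontrivial H := by
    by_contra h
    have := not_nontrivial_iff_subsingleton.1 h
    have := hF.2.1
    rw [Subsingleton.elim F 0, norm_zero] at this
    exact zero_ne_one this
  have hsp : (1 : ℂ) ∈ spectrum ℂ G := by
    rw [spectrum.mem_iff, IsUnit.sub_iff]
    intro hu
    refine h1 ?_
    rw [one_smul]
    rw [map_one] at hu
    obtain ⟨v, hv⟩ := hu
    rw [← hv]
    refine isFredholm_of_isCompactOperator (v := ↑v⁻¹) ?_ ?_
    · rw [Units.inv_mul, sub_self]
      exact isCompactOperator_zero
    · rw [Units.mul_inv, sub_self]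
      exact isCompactOperator_zero
  simpa using spectrum.norm_le_norm_of_mem hsp

theorem linePath_apply (F : H →L[ℂ] H) (U : unitary (H →L[ℂ] H)) (s : unitInterval) :
    linePath F U s = (1 - (s : ℝ)) • F +
      (s : ℝ) • (star (U : H →L[ℂ] H) * F * (U : H →L[ℂ] H)) := by
  have hU : star (U : H →L[ℂ] H) * (U : H →L[ℂ] H) = 1 := Unitary.coe_star_mul_self U
  have h : star (U : H →L[ℂ] H) * comm F U = star (U : H →L[ℂ] H) * F * (U : H →L[ℂ] H) - F := by
    rw [comm, mul_sub, ← mul_assoc, ← mul_assoc, hU, one_mul]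
  change F + (s : ℝ) • (star (U : H →L[ℂ] H) * comm F U) = _
  rw [h, smul_sub, sub_smul, one_smul]
  abel

theorem linePath_mem_Theta {F : H →L[ℂ] H} (hF : F ∈ SFHat H) {U : unitary (H →L[ℂ] H)}
    (hc : IsCompactOperator (comm F U)) : linePath F U ∈ Theta F U := by
  have hcomp : ∀ t, IsCompactOperator (linePath F U t - F) := fun t => by
    have : linePath F U t - F = (((t : ℝ) : ℂ) • star (U : H →L[ℂ] H)) * comm F U := by
      change F + (t : ℝ) • (star (U : H →L[ℂ] H) * comm F U) - F = _
      rw [add_sub_cancel_left, smul_mul_assoc, Complex.coe_smul]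
    rw [this]
    exact isCompactOperator_mul_left hc _
  refine ⟨fun t => mem_SFHat_of_isCompactOperator_sub hF ?_ ?_ (hcomp t), ?_, hcomp, ?_⟩
  · rw [linePath_apply]
    exact ((IsSelfAdjoint.all _).smul hF.1.1).add
      ((IsSelfAdjoint.all _).smul (hF.1.1.conjugate' _))
  · rw [linePath_apply]
    have h₁ : ‖star (U : H →L[ℂ] H) * F * (U : H →L[ℂ] H)‖ = 1 := by
      rw [CStarRing.norm_mul_coe_unitary, ← Unitary.coe_star, CStarRing.norm_coe_unitary_mul,
        hF.2.1]
    refine (norm_add_le _ _).trans ?_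
    rw [norm_smul, norm_smul, h₁, hF.2.1, Real.norm_of_nonneg (sub_nonneg.2 t.2.2),
      Real.norm_of_nonneg t.2.1]
    linarith
  · simp [linePath_apply]
  · simp [linePath_apply]

theorem isCompactOperator_comm_of_mem_Theta {F : H →L[ℂ] H} {U : unitary (H →L[ℂ] H)}
    {γ : C(unitInterval, H →L[ℂ] H)} (hγ : γ ∈ Theta F U) : IsCompactOperator (comm F U) := by
  have h := hγ.2.2.1 1
  rw [hγ.2.2.2] at h
  have hU : (U : H →L[ℂ] H) * star (U : H →L[ℂ] H) = 1 := Unitary.coe_mul_star_self U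
  have : comm F U = (U : H →L[ℂ] H) * (star (U : H →L[ℂ] H) * F * (U : H →L[ℂ] H) - F) := by
    rw [comm, mul_sub, ← mul_assoc, ← mul_assoc, hU, one_mul]
  rw [this]
  exact isCompactOperator_mul_left h _

theorem flow_eq_of_mem_Theta {F : H →L[ℂ] H} {U : unitary (H →L[ℂ] H)}
    {γ : C(unitInterval, H →L[ℂ] H)} (hγ : γ ∈ Theta F U) (D : SpectralPartition γ) :
    D.flow = (relIndex (lowerProj F 0)
      (lowerProj (star (U : H →L[ℂ] H) * F * (U : H →L[ℂ] H)) 0) : ℂ) := by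
  have h := flow_eq_relIndex hγ.1 (fun s t => by
    have := (hγ.2.2.1 s).sub (hγ.2.2.1 t)
    rwa [← FunLike.coe_sub, sub_sub_sub_cancel_right] at this) D
  rwa [hγ.2.1, hγ.2.2.2] at h

theorem spectralFlow_eq_of_mem_Theta {F : H →L[ℂ] H} {U : unitary (H →L[ℂ] H)}
    {γ : C(unitInterval, H →L[ℂ] H)} (hγ : γ ∈ Theta F U) :
    spectralFlow γ = relIndex (lowerProj F 0)
      (lowerProj (star (U : H →L[ℂ] H) * F * (U : H →L[ℂ] H)) 0) := by
  obtain ⟨D⟩ := nonempty_spectralPartition hγ.1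
  -- Existence of a partition makes the choice meaningful; whichever partition realises the chosen
  -- integer, its flow is the relative index.
  obtain ⟨D', hD'⟩ := Classical.epsilon_spec
    (p := fun n : ℤ => ∃ D : SpectralPartition γ, D.flow = (n : ℂ))
    ⟨_, D, flow_eq_of_mem_Theta hγ D⟩
  rw [flow_eq_of_mem_Theta hγ D'] at hD'
  exact (Int.cast_injective hD').symm

theorem spectralFlow_eq_spectralFlowPair {F : H →L[ℂ] H} {U : unitary (H →L[ℂ] H)}
    {γ : C(unitInterval, H →L[ℂ] H)} (hγ : γ ∈ Theta F U) :
    spectralFlow γ = spectralFlowPair F U := by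
  have h : (Theta F U).Nonempty := ⟨γ, hγ⟩
  rw [spectralFlowPair, dif_pos h, spectralFlow_eq_of_mem_Theta hγ,
    spectralFlow_eq_of_mem_Theta h.some_mem]

end Main

end SpecFlow

end

theorem mainTheorem8 {H : Type*} [NormedAddCommGroup H] [InnerProductSpace ℂ H] [CompleteSpace H]
    [TopologicalSpace.SeparableSpace H]
    (F : H →L[ℂ] H) (hF : F ∈ SpecFlow.SFHat H) (U : unitary (H →L[ℂ] H)) :
    (∀ γ ∈ SpecFlow.Theta F U,
      Nonempty (SpecFlow.SpectralPartition γ) ∧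
      (∀ D : SpecFlow.SpectralPartition γ, D.flow = (SpecFlow.spectralFlow γ : ℂ)) ∧
      SpecFlow.spectralFlow γ = SpecFlow.spectralFlowPair F U) ∧
    ((SpecFlow.Theta F U).Nonempty ↔ IsCompactOperator (SpecFlow.comm F U)) ∧
    (IsCompactOperator (SpecFlow.comm F U) →
      SpecFlow.linePath F U ∈ SpecFlow.Theta F U ∧
      SpecFlow.spectralFlowPair F U = SpecFlow.spectralFlow (SpecFlow.linePath F U)) := by

  refine ⟨fun γ hγ => ⟨SpecFlow.nonempty_spectralPartition hγ.1, fun D => ?_,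
    SpecFlow.spectralFlow_eq_spectralFlowPair hγ⟩,
    ⟨fun ⟨γ, hγ⟩ => SpecFlow.isCompactOperator_comm_of_mem_Theta hγ,
      fun h => ⟨_, SpecFlow.linePath_mem_Theta hF h⟩⟩,
    fun h => ⟨SpecFlow.linePath_mem_Theta hF h,
      (SpecFlow.spectralFlow_eq_spectralFlowPair (SpecFlow.linePath_mem_Theta hF h)).symm⟩⟩
  rw [SpecFlow.flow_eq_of_mem_Theta hγ D, SpecFlow.spectralFlow_eq_of_mem_Theta hγ]
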